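/- Let $E$ be a Borel space and let $Q$ be a semi-Markov kernel on $\mathbb{R}_+\times E$ given $E$: for $x\in E$ and Borel $B\subset E$, $t\mapsto Q(t,B|x)$ is non-decreasing and right-continuous on $\mathbb{R}_+$ with $Q(0,B|x)=0$; $Q(t,\cdot|\cdot)$ is a sub-stochastic kernel for every $t\ge 0$; and $\lim_{t\to\infty}Q(t,\cdot|\cdot)$ is a stochastic kernel. Assume that there are $\delta>0$ and $\varepsilon>0$ with $Q(\delta,E|x)\le 1-\varepsilon$ for all $x\in E$. Let $c,g:E\to[0,\infty)$ be measurable and let $T\ge 0$. *Stopping problem.* Let $\mathbb{P}_x$ be the law of the sequence $(T_n,X_n)_{n\ge 0}$ with $T_0=0$, $X_0=x$ and $\mathbb{P}_x(T_{n+1}\le t,\,X_{n+1}\in B\mid X_0,T_1,X_1,\dots,T_n,X_n)=Q(t,B|X_n)$. Put $S_n=\sum_{k=0}^nT_k$, $S_\infty=\infty$, and $X(t)=X_n$ for $S_n\le t<S_{n+1}$. A stopping time is a map $\tau$ with values in $\mathbb{N}\cup\{\infty\}$ that is a stopping time for the filtration $\sigma(T_0,X_0,\dots,T_n,X_n)$,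 $n\ge 0$. For a stopping time $\tau$ and $s\ge 0$ let $V^\tau(s,x)=\mathbb{E}_x[R^s_\tau]\in[0,\infty]$, where $R^s_\tau=\int_0^{S_\tau}c(X(t))\,dt+g(X(S_\tau))$ if $S_\tau<s$ and $R^s_\tau=\int_0^{s}c(X(t))\,dt$ if $S_\tau\ge s$. *Auxiliary decision process.* Consider the semi-Markov decision process with state space $\hat E=E\cup\{\Delta\}$ ($\Delta\notin E$), actions $0$ (continue) and $1$ (stop), admissible actions $A(x)=\{0,1\}$ for $x\in E$ and $A(\Delta)=\{1\}$, semi-Markov kernel $\hat Q_T(t,B|x,0)=Q(t,B\setminus\{\Delta\}|x)$ for $x\in E$ and $\hat Q_T(t,B|x,1)=\mathbf 1_{[T+1,\infty)}(t)\,\delta_\Delta(B)$ for $x\in\hat E$, cost rate $\hat c(x,0)=c(x)$ for $x\in E$ and $\hat c=0$ otherwise, and terminal cost $\hat g(x,1)=g(x)$ for $x\in E$ and $\hat g=0$ otherwise. A deterministic policy is a sequence $\pi=\{d_n\}_{n\ge0}$ of measurable functions $d_n(s,\hat h_n)\in A(x_n)$ of a real number $s$ (the remaining horizon) and an admissible history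 $\hat h_n=(x_0,a_0,t_1,x_1,\dots,a_{n-1},t_n,x_n)$. Under the law $\hat{\mathbb{P}}^\pi_{(s,x)}$ of $(\hat T_n,\hat X_n,A_n)_{n\ge 0}$, with $\hat S_n=\sum_{k=0}^n\hat T_k$, one has $\hat T_0=0$, $\hat X_0=x$, $A_n=d_n(s-\hat S_n,\hat Y_n)$ with $\hat Y_n=(\hat X_0,A_0,\hat T_1,\hat X_1,\dots,A_{n-1},\hat T_n,\hat X_n)$, and $\hat{\mathbb{P}}^\pi_{(s,x)}(\hat T_{n+1}\le t,\,\hat X_{n+1}\in B\mid\hat Y_n,A_n)=\hat Q_T(t,B|\hat X_n,A_n)$. With $(\hat X(t),A(t))=(\hat X_n,A_n)$ for $\hat S_n\le t<\hat S_{n+1}$, put $$U^\pi(s,x)=\hat{\mathbb{E}}^\pi_{(s,x)}\Big[\int_0^s\hat c(\hat X(t),A(t))\,dt+\hat g(\hat X(s),A(s))\Big]\in[0,\infty].$$ (All costs are taken to be $0$ at and after an accumulation point of the jump times; this concerns a null event only.) *Claim.* Let $\Pi^0_{DH}$ be the set of deterministic policies with $d_n(0,\hat h_n)=0$ for all $n\ge0$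 and all histories $\hat h_n=(x_0,0,t_1,x_1,\dots,0,t_n,x_n)$ with all $x_m\in E$ and all actions $0$. For $\pi=\{d_n\}\in\Pi^0_{DH}$ and $s\in\mathbb{R}$, let $$\tau_\pi^s=\inf\{n\in\mathbb{N}: d_n(s-S_n,(X_0,0,T_1,X_1,\dots,0,T_n,X_n))=1\}\qquad(\inf\emptyset=\infty)$$ be the stopping time induced by $\pi$ and $s$. Then, for every $\pi\in\Pi^0_{DH}$, $$U^\pi(s,x)=V^{\tau_\pi^s}(s,x)\qquad\text{for all }x\in E,\ s\in[0,T].$$ -/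

import Mathlib

open MeasureTheory ProbabilityTheory Set Filter Topology
open scoped ENNReal NNReal

noncomputable section

/-- A semi-Markov kernel on `[0, ∞) × β` given `α`: `law t x B` is the number `Q(t, B | x)`.
It is non-decreasing and right-continuous in `t` with value `0` at `t = 0`, a sub-stochastic kernel
for each `t`, and a stochastic kernel in the limit `t → ∞`. -/
structure SemiMarkovKernel (α β : Type*) [MeasurableSpace α] [MeasurableSpace β] where
  law : ℝ≥0 → Kernel α β
  mono : ∀ (x : α) (B : Set β), MeasurableSet B → Monotone fun t => law t x B
  rightCts : ∀ (x : α) (B : Set β), MeasurableSet B →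
    ∀ t : ℝ≥0, ContinuousWithinAt (fun u => law u x B) (Ici t) t
  zero : ∀ (x : α) (B : Set β), MeasurableSet B → law 0 x B = 0
  sub : ∀ (t : ℝ≥0) (x : α), law t x univ ≤ 1
  total : ∀ x : α, Tendsto (fun t => law t x univ) atTop (𝓝 1)

namespace SemiMarkovKernel

variable {α β : Type*} [MeasurableSpace α] [MeasurableSpace β] (Q : SemiMarkovKernel α β)

instance isFiniteKernel_law (t : ℝ≥0) : IsFiniteKernel (Q.law t) :=
  ⟨1, ENNReal.one_lt_top, fun x => Q.sub t x⟩

theorem law_le (x : α) {s t : ℝ≥0} (h : s ≤ t) : Q.law s x ≤ Q.law t x :=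
  Measure.le_iff.2 fun B hB => Q.mono x B hB h

/-- The limit kernel of `Q(t, · | ·)` as `t → ∞`. -/
theorem exists_limit : ∃ κ : Kernel α β, IsMarkovKernel κ ∧ (∀ t x, Q.law t x ≤ κ x) := by
  have hmono : ∀ x B, MeasurableSet B → Monotone fun n : ℕ => Q.law n x B :=
    fun x B hB m n h => Q.mono x B hB (by exact_mod_cast h)
  let μ : α → Measure β := fun x => Measure.ofMeasurable (fun B _ => ⨆ n : ℕ, Q.law n x B)
    (by simp) (by
      intro f hf hd
      simp_rw [measure_iUnion hd hf, ENNReal.tsum_eq_iSup_sum]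
      rw [iSup_comm]
      congr 1; ext s
      exact (ENNReal.finsetSum_iSup_of_monotone fun i => hmono x (f i) (hf i)).symm)
  have hμ : ∀ x B, MeasurableSet B → μ x B = ⨆ n : ℕ, Q.law n x B :=
    fun x B hB => Measure.ofMeasurable_apply B hB
  have hle : ∀ t x, Q.law t x ≤ μ x := by
    intro t x
    refine Measure.le_iff.2 fun B hB => ?_
    obtain ⟨n, hn⟩ := exists_nat_ge t
    rw [hμ x B hB]
    exact (Q.mono x B hB hn).trans (le_iSup (fun n : ℕ => Q.law n x B) n)
  refine ⟨⟨μ, Measure.measurable_of_measurable_coe _ fun B hB => ?_⟩, ⟨fun x => ⟨?_⟩⟩, hle⟩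
  · simp_rw [hμ _ B hB]
    exact Measurable.iSup fun n => (Q.law n).measurable_coe hB
  · change μ x univ = 1
    rw [hμ x _ .univ]
    refine tendsto_nhds_unique (tendsto_atTop_iSup (hmono x _ .univ)) ?_
    exact (Q.total x).comp tendsto_natCast_atTop_atTop

/-- A semi-Markov kernel is the distribution function in `t` of a Markov kernel `Q(dt, dy | x)` on
`[0, ∞) × β`. (These rectangles form a generating π-system, so that this kernel is unique.) -/
theorem exists_joint [MeasurableSpace.CountablyGenerated β] :
    ∃ κ : Kernel α (ℝ≥0 × β), IsMarkovKernel κ ∧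
      ∀ (x : α) (t : ℝ≥0) (B : Set β), MeasurableSet B → κ x (Iic t ×ˢ B) = Q.law t x B := by
  obtain ⟨η, hη, hle⟩ := Q.exists_limit
  let r : ℝ≥0 → α → β → ℝ≥0∞ := fun t => Kernel.rnDeriv (Q.law t) η
  have hrm : ∀ t x, Measurable (r t x) := fun t x => Kernel.measurable_rnDeriv_right _ _ _
  have hr : ∀ t x B, MeasurableSet B → ∫⁻ y in B, r t x y ∂(η x) = Q.law t x B := by
    intro t x B hB
    have h := Kernel.withDensity_rnDeriv_eq (κ := Q.law t) (η := η) (a := x)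
      (Measure.absolutelyContinuous_of_le (hle t x))
    rw [Kernel.withDensity_apply _ (Kernel.measurable_rnDeriv _ _)] at h
    rw [← h, withDensity_apply _ hB]
  have hru : ∀ t x, ∫⁻ y, r t x y ∂(η x) = Q.law t x univ := by
    intro t x; simpa using hr t x univ .univ
  have hrle : ∀ s t x, s ≤ t → r s x ≤ᵐ[η x] r t x := by
    intro s t x hst
    refine ae_le_of_forall_setLIntegral_le_of_sigmaFinite (hrm s x) fun B hB _ => ?_
    rw [hr _ _ _ hB, hr _ _ _ hB]
    exact Q.mono x B hB hst
  have hr1 : ∀ t x, r t x ≤ᵐ[η x] fun _ => 1 := by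
    intro t x
    refine ae_le_of_forall_setLIntegral_le_of_sigmaFinite (hrm t x) fun B hB _ => ?_
    rw [hr _ _ _ hB]
    simpa using hle t x B
  -- right limits
  have hinf : ∀ (t : ℝ≥0) x B, MeasurableSet B →
      ∀ c : ℝ≥0∞, (∀ q : ℚ, (t : ℝ) < q → c ≤ Q.law (Real.toNNReal q) x B) → c ≤ Q.law t x B := by
    intro t x B hB c hc
    have h1 : Tendsto (fun u => Q.law u x B) (𝓝[>] t) (𝓝 (Q.law t x B)) :=
      (Q.rightCts x B hB t).mono_left (nhdsWithin_mono _ Ioi_subset_Ici_self)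
    refine ge_of_tendsto h1 ?_
    filter_upwards [self_mem_nhdsWithin] with u hu
    obtain ⟨q, hq1, hq2⟩ := exists_rat_btwn (NNReal.coe_lt_coe.2 hu)
    refine (hc q hq1).trans (Q.mono x B hB ?_)
    exact Real.toNNReal_le_iff_le_coe.2 hq2.le
  let f : α × β → ℚ → ℝ := fun p q => (r (Real.toNNReal q) p.1 p.2).toReal
  have hf : Measurable f := measurable_pi_lambda _ fun q =>
    (Kernel.measurable_rnDeriv (Q.law (Real.toNNReal q)) η).ennreal_toReal
  have hpt : ∀ x, ∀ᵐ y ∂(η x), IsRatStieltjesPoint f (x, y) := by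
    intro x
    have e1 : ∀ᵐ y ∂(η x), ∀ q : ℚ, r (Real.toNNReal q) x y ≤ 1 :=
      ae_all_iff.2 fun q => hr1 _ x
    have e2 : ∀ᵐ y ∂(η x), ∀ q q' : ℚ, q ≤ q' →
        r (Real.toNNReal q) x y ≤ r (Real.toNNReal q') x y := by
      refine ae_all_iff.2 fun q => ae_all_iff.2 fun q' => ?_
      by_cases h : q ≤ q'
      · filter_upwards [hrle _ _ x (Real.toNNReal_mono (Rat.cast_le.2 h))] with y hy _ using hy
      · exact Eventually.of_forall fun y h' => absurd h' h
    have e3 : ∀ᵐ y ∂(η x), r 0 x y = 0 := by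
      refine (lintegral_eq_zero_iff (hrm 0 x)).1 ?_
      rw [hru, Q.zero x _ .univ]
    have e4 : (fun y => ⨆ n : ℕ, r n x y) =ᵐ[η x] fun _ => 1 := by
      refine ae_eq_of_ae_le_of_lintegral_le ?_ ?_ aemeasurable_const ?_
      · filter_upwards [ae_all_iff.2 fun n : ℕ => hr1 n x] with y hy using iSup_le hy
      · refine ne_top_of_le_ne_top (b := 1) (by simp) ?_
        calc _ ≤ ∫⁻ _, 1 ∂(η x) := lintegral_mono_ae (by
              filter_upwards [ae_all_iff.2 fun n : ℕ => hr1 n x] with y hy using iSup_le hy)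
          _ = 1 := by simp
      · simp only [lintegral_const, measure_univ, mul_one]
        refine le_of_tendsto' ((Q.total x).comp tendsto_natCast_atTop_atTop) fun n => ?_
        simp only [Function.comp]
        rw [← hru]
        exact lintegral_mono fun y => le_iSup (fun n : ℕ => r n x y) n
    have e5 : ∀ᵐ y ∂(η x), ∀ q : ℚ, r (Real.toNNReal q) x y =
        ⨅ q' : Ioi q, r (Real.toNNReal (q' : ℚ)) x y := by
      refine ae_all_iff.2 fun q => ?_
      refine ae_eq_of_ae_le_of_lintegral_le ?_ ?_ ?_ ?_
      · filter_upwards [e2] with y hy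
        exact le_iInf fun q' => hy _ _ q'.2.le
      · rw [hru]; exact measure_ne_top _ _
      · exact (Measurable.iInf fun q' => hrm _ x).aemeasurable
      · rw [hru]
        by_cases hq : 0 ≤ q
        · refine hinf _ x _ .univ _ fun q' hq' => ?_
          rw [← hru]
          refine lintegral_mono fun y => ?_
          refine iInf_le (fun q' : Ioi q => r (Real.toNNReal (q' : ℚ)) x y) ⟨q', ?_⟩
          rw [Real.coe_toNNReal _ (by exact_mod_cast hq)] at hq'
          exact_mod_cast hq'
        · have hq0 : (q : ℝ) < ((0 : ℚ) : ℝ) := by exact_mod_cast lt_of_not_ge hq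
          have : Q.law (Real.toNNReal q) x univ = Q.law (Real.toNNReal (0 : ℚ)) x univ := by
            rw [Real.toNNReal_of_nonpos (by simpa using hq0.le)]; simp
          rw [this, ← hru]
          exact lintegral_mono fun y => iInf_le
            (fun q' : Ioi q => r (Real.toNNReal (q' : ℚ)) x y) ⟨0, by exact_mod_cast hq0⟩
    filter_upwards [e1, e2, e3, e4, e5] with y h1 h2 h3 h4 h5
    have hfin : ∀ q : ℚ, r (Real.toNNReal q) x y ≠ ∞ :=
      fun q => ne_top_of_le_ne_top (by simp) (h1 q)
    have hm : Monotone (f (x, y)) := fun q q' h => ENNReal.toReal_mono (hfin _) (h2 q q' h)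
    refine ⟨hm, ?_, ?_, ?_⟩
    · have hmn : Monotone fun n : ℕ => r n x y := by
        intro m n h
        have := h2 m n (by exact_mod_cast h)
        simpa using this
      have ht : Tendsto (fun n : ℕ => r n x y) atTop (𝓝 1) := h4 ▸ tendsto_atTop_iSup hmn
      have ht' : Tendsto (fun n : ℕ => f (x, y) n) atTop (𝓝 1) := by
        have := (ENNReal.tendsto_toReal (by simp : (1 : ℝ≥0∞) ≠ ∞)).comp ht
        simpa [f, Function.comp_def] using this
      have hbd : ∀ q, f (x, y) q ≤ 1 := fun q =>
        ENNReal.toReal_le_of_le_ofReal zero_le_one (by simpa using h1 q)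
      refine tendsto_order.2 ⟨fun a ha => ?_, fun a ha => Eventually.of_forall fun q =>
        (hbd q).trans_lt ha⟩
      obtain ⟨n, hn⟩ := ((tendsto_order.1 ht').1 a ha).exists
      filter_upwards [eventually_ge_atTop (n : ℚ)] with q hq using hn.trans_le (hm hq)
    · refine tendsto_const_nhds.congr' ?_
      filter_upwards [eventually_le_atBot (0 : ℚ)] with q hq
      simp [f, Real.toNNReal_of_nonpos (show (q : ℝ) ≤ 0 by exact_mod_cast hq), h3]
    · intro q
      simp only [f]
      rw [h5 q, ENNReal.toReal_iInf fun i => hfin _]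
  let K : Kernel (α × β) ℝ :=
    ⟨fun p => (stieltjesOfMeasurableRat f hf p).measure,
      measurable_measure_stieltjesOfMeasurableRat hf⟩
  have : IsMarkovKernel K :=
    ⟨fun p => instIsProbabilityMeasure_stieltjesOfMeasurableRat hf p⟩
  have hφ : Measurable fun p : β × ℝ => (Real.toNNReal p.2, p.1) := by fun_prop
  refine ⟨(η ⊗ₖ K).map fun p => (Real.toNNReal p.2, p.1), Kernel.IsMarkovKernel.map _ hφ, ?_⟩
  intro x t B hB
  rw [Kernel.map_apply' _ hφ _ (measurableSet_Iic.prod hB)]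
  have hpre : (fun p : β × ℝ => (Real.toNNReal p.2, p.1)) ⁻¹' (Iic t ×ˢ B) = B ×ˢ Iic (t : ℝ) := by
    ext p; simp [and_comm, Real.toNNReal_le_iff_le_coe]
  rw [hpre, Kernel.compProd_apply_prod hB measurableSet_Iic]
  have hK : ∀ y, K (x, y) (Iic (t : ℝ)) =
      ENNReal.ofReal (stieltjesOfMeasurableRat f hf (x, y) t) :=
    fun y => measure_stieltjesOfMeasurableRat_Iic hf (x, y) t
  have hKq : ∀ q : ℚ, ∀ᵐ y ∂(η x), K (x, y) (Iic (q : ℝ)) = r (Real.toNNReal q) x y := by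
    intro q
    filter_upwards [hpt x, hr1 (Real.toNNReal q) x] with y hy h1
    change (stieltjesOfMeasurableRat f hf (x, y)).measure (Iic (q : ℝ)) = _
    rw [measure_stieltjesOfMeasurableRat_Iic, stieltjesOfMeasurableRat_eq,
      toRatCDF_of_isRatStieltjesPoint hy, ENNReal.ofReal_toReal]
    exact ne_top_of_le_ne_top (by simp) h1
  apply le_antisymm
  · refine hinf t x B hB _ fun q hq => ?_
    rw [← hr _ _ _ hB]
    refine setLIntegral_mono_ae (hrm _ x).aemeasurable ?_
    filter_upwards [hKq q] with y hy _
    rw [← hy]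
    exact measure_mono (Iic_subset_Iic.2 hq.le)
  · rw [← hr _ _ _ hB]
    refine setLIntegral_mono_ae ?_ ?_
    · exact ((Kernel.measurable_coe K measurableSet_Iic).comp measurable_prodMk_left).aemeasurable
    · have h2 : ∀ᵐ y ∂(η x), ∀ q : ℚ, (t : ℝ) < q → r t x y ≤ K (x, y) (Iic (q : ℝ)) := by
        refine ae_all_iff.2 fun q => ?_
        by_cases hq : (t : ℝ) < q
        · filter_upwards [hKq q, hrle t (Real.toNNReal q) x
            (NNReal.le_toNNReal_of_coe_le hq.le)] with y h1 h2 _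
          rw [h1]; exact h2
        · exact Eventually.of_forall fun y h => absurd h hq
      filter_upwards [h2, hr1 t x] with y hy hy1 _
      have hrfin : r t x y ≠ ∞ := ne_top_of_le_ne_top (by simp) hy1
      rw [hK, ← ENNReal.ofReal_toReal hrfin]
      refine ENNReal.ofReal_le_ofReal ?_
      rw [← StieltjesFunction.iInf_rat_gt_eq]
      have : Nonempty {q' : ℚ // (t : ℝ) < q'} :=
        let ⟨q, hq⟩ := exists_rat_gt (t : ℝ); ⟨⟨q, hq⟩⟩
      refine le_ciInf fun q => ?_
      have := hy q q.2
      change _ ≤ (stieltjesOfMeasurableRat f hf (x, y)).measure (Iic ((q : ℚ) : ℝ)) at this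
      rw [measure_stieltjesOfMeasurableRat_Iic] at this
      exact ENNReal.toReal_le_of_le_ofReal (stieltjesOfMeasurableRat_nonneg hf _ _) this


/-- The joint law of the sojourn time and the next state. -/
def joint [MeasurableSpace.CountablyGenerated β] : Kernel α (ℝ≥0 × β) := Q.exists_joint.choose

instance isMarkovKernel_joint [MeasurableSpace.CountablyGenerated β] : IsMarkovKernel Q.joint :=
  Q.exists_joint.choose_spec.1

theorem joint_apply [MeasurableSpace.CountablyGenerated β] (x : α) (t : ℝ≥0) {B : Set β}
    (hB : MeasurableSet B) : Q.joint x (Iic t ×ˢ B) = Q.law t x B :=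
  Q.exists_joint.choose_spec.2 x t B hB

end SemiMarkovKernel

/-! ### Marked point process paths -/

/-- Sample paths `(t_0, x_0), (t_1, x_1), …` of a marked point process. The coordinate `t_0` is a
dummy: the sojourn time of index `0` is `0` by definition. -/
abbrev MarkedPath (X : Type*) := ℕ → ℝ≥0 × X

namespace MarkedPath

variable {X : Type*}

/-- `T_0 = 0`, and `T_n` is the sojourn time between the jumps of index `n - 1` and `n`. -/
def sojourn (n : ℕ) (ω : MarkedPath X) : ℝ≥0 := if n = 0 then 0 else (ω n).1

/-- The mark `X_n` at the jump of index `n`. -/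
def mark (n : ℕ) (ω : MarkedPath X) : X := (ω n).2

/-- The jump time `S_n = T_0 + ⋯ + T_n`. -/
def jumpTime (n : ℕ) (ω : MarkedPath X) : ℝ≥0 := ∑ k ∈ Finset.range (n + 1), sojourn k ω

open Classical in
/-- The continuous-time process: the mark `X_n` if `S_n ≤ t < S_{n+1}`; the extra point `none` if there
is no such `n`. -/
def atTime (t : ℝ) (ω : MarkedPath X) : Option X :=
  if h : ∃ n, (jumpTime n ω : ℝ) ≤ t ∧ t < jumpTime (n + 1) ω then
    some (mark (Nat.find h) ω)
  else none

/-- The value of `f` at the current mark; it is `0` at the extra point `none`. -/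
def valueAt (f : X → ℝ≥0) (t : ℝ) (ω : MarkedPath X) : ℝ≥0∞ :=
  (atTime t ω).elim 0 fun x => (f x : ℝ≥0∞)

/-- The accumulated cost `∫_0^u f(X(t)) dt`. -/
def accumulated (f : X → ℝ≥0) (u : ℝ) (ω : MarkedPath X) : ℝ≥0∞ :=
  ∫⁻ t in Icc (0 : ℝ) u, valueAt f t ω

/-- `S_n` for `n ∈ ℕ ∪ {∞}`, with `S_∞ = ∞`. -/
def jumpTimeAt (n : ℕ∞) (ω : MarkedPath X) : ℝ≥0∞ :=
  if n = ⊤ then ∞ else (jumpTime n.toNat ω : ℝ≥0∞)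

variable [MeasurableSpace X]

theorem measurable_sojourn (n : ℕ) : Measurable (sojourn n : MarkedPath X → ℝ≥0) := by
  unfold sojourn
  split_ifs
  · exact measurable_const
  · fun_prop

theorem measurable_mark (n : ℕ) : Measurable (mark n : MarkedPath X → X) := by
  unfold mark; fun_prop

/-- The filtration `σ(T_0, X_0, …, T_n, X_n)`. -/
def filtration (X : Type*) [MeasurableSpace X] :
    Filtration ℕ (inferInstance : MeasurableSpace (MarkedPath X)) where
  seq n := ⨆ k ≤ n, (MeasurableSpace.comap (sojourn k) inferInstance ⊔
    MeasurableSpace.comap (mark k) inferInstance)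
  mono' _ _ h := biSup_mono fun _ hk => hk.trans h
  le' _ := iSup₂_le fun k _ =>
    sup_le (measurable_sojourn k).comap_le (measurable_mark k).comap_le

theorem measurable_sojourn_filtration {k n : ℕ} (h : k ≤ n) :
    Measurable[filtration X n] (sojourn k : MarkedPath X → ℝ≥0) :=
  Measurable.of_comap_le (le_sup_left.trans (le_iSup₂_of_le (f := fun k (_ : k ≤ n) =>
    MeasurableSpace.comap (sojourn k) inferInstance ⊔
    MeasurableSpace.comap (mark (X := X) k) inferInstance) k h le_rfl))

theorem measurable_mark_filtration {k n : ℕ} (h : k ≤ n) :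
    Measurable[filtration X n] (mark k : MarkedPath X → X) :=
  Measurable.of_comap_le (le_sup_right.trans (le_iSup₂_of_le (f := fun k (_ : k ≤ n) =>
    MeasurableSpace.comap (sojourn (X := X) k) inferInstance ⊔
    MeasurableSpace.comap (mark k) inferInstance) k h le_rfl))

theorem measurable_jumpTime_filtration {k n : ℕ} (h : k ≤ n) :
    Measurable[filtration X n] (jumpTime k : MarkedPath X → ℝ≥0) := by
  unfold jumpTime
  exact Finset.measurable_fun_sum _ fun i hi =>
    measurable_sojourn_filtration (by have := Finset.mem_range.1 hi; omega)

end MarkedPath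

open MarkedPath

/-! ### Optimal stopping of a semi-Markov process -/

section SMP

variable {E : Type*} [MeasurableSpace E] [StandardBorelSpace E]

/-- The law `P_x` of the semi-Markov process: `T_0 = 0`, `X_0 = x`, and given the past up to the `n`-th
jump, `(T_{n+1}, X_{n+1})` has law `Q(dt, dy | X_n)`. -/
def smpMeasure (Q : SemiMarkovKernel E E) (x : E) : Measure (MarkedPath E) :=
  Kernel.trajMeasure (X := fun _ => ℝ≥0 × E) (Measure.dirac (0, x)) fun n =>
    Q.joint.comap (fun h : (i : Finset.Iic n) → ℝ≥0 × E => (h ⟨n, Finset.mem_Iic.2 le_rfl⟩).2)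
      (by fun_prop)

/-- Stopping times with values in `ℕ ∪ {∞}`. -/
def StoppingTime (E : Type*) [MeasurableSpace E] :=
  {τ : MarkedPath E → ℕ∞ // IsStoppingTime (filtration E) τ}

/-- The cost `R_τ^s`: `∫_0^{S_τ} c(X(t)) dt + g(X(S_τ))` if `S_τ < s`, and `∫_0^s c(X(t)) dt`
otherwise. -/
def stoppingCost (c g : E → ℝ≥0) (s : ℝ≥0) (τ : StoppingTime E) (ω : MarkedPath E) : ℝ≥0∞ :=
  if jumpTimeAt (τ.1 ω) ω < s then
    accumulated c (jumpTimeAt (τ.1 ω) ω).toReal ω + valueAt g (jumpTimeAt (τ.1 ω) ω).toReal ω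
  else accumulated c s ω

/-- `V^τ(s, x)`, the `s`-horizon expected cost of the stopping time `τ`. -/
def expectedStoppingCost (Q : SemiMarkovKernel E E) (c g : E → ℝ≥0) (τ : StoppingTime E)
    (s : ℝ≥0) (x : E) : ℝ≥0∞ :=
  ∫⁻ ω, stoppingCost c g s τ ω ∂(smpMeasure Q x)

end SMP

/-! ### Semi-Markov decision processes -/

/-- A semi-Markov decision process with state space `S`, action space `A`, finite sets `act x` of
admissible actions, and semi-Markov kernel `Q`, cost rate `c` and terminal cost `g` on the set of
admissible state-action pairs. -/
structure SMDP (S A : Type*) [MeasurableSpace S] [MeasurableSpace A] where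
  act : S → Set A
  finite_act : ∀ x, (act x).Finite
  measurableSet_pairs : MeasurableSet {p : S × A | p.2 ∈ act p.1}
  exists_selector : ∃ f : ℝ × S → A, Measurable f ∧ ∀ t x, f (t, x) ∈ act x
  Q : SemiMarkovKernel {p : S × A // p.2 ∈ act p.1} S
  c : {p : S × A // p.2 ∈ act p.1} → ℝ≥0
  g : {p : S × A // p.2 ∈ act p.1} → ℝ≥0
  measurable_c : Measurable c
  measurable_g : Measurable g

namespace SMDP

variable {S A : Type*} [MeasurableSpace S] [MeasurableSpace A] (M : SMDP S A)

/-- The admissible state-action pairs. -/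
abbrev Pair := {p : S × A // p.2 ∈ M.act p.1}

/-- Admissible histories `(x_0, a_0, t_1, x_1, …, a_{n-1}, t_n, x_n)`, listed as the pairs
`(x_m, a_m)` for `m < n`, the sojourn times `t_1, …, t_n`, and the current state `x_n`. -/
abbrev Hist (n : ℕ) := (Fin n → M.Pair) × (Fin n → ℝ≥0) × S

variable {M} in
/-- `t_1 + ⋯ + t_n`. -/
def elapsed {n : ℕ} (h : M.Hist n) : ℝ≥0 := ∑ m, h.2.1 m

theorem measurable_elapsed (n : ℕ) : Measurable (elapsed : M.Hist n → ℝ≥0) := by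
  unfold elapsed; fun_prop

/-- A policy: stochastic kernels on `A` given (remaining horizon, history), concentrated on the
admissible actions at the current state. -/
structure Policy where
  ker : (n : ℕ) → Kernel (ℝ × M.Hist n) A
  isMarkovKernel : ∀ n, IsMarkovKernel (ker n)
  admissible : ∀ (n : ℕ) (s : ℝ) (h : M.Hist n), ker n (s, h) (M.act h.2.2) = 1

/-- A deterministic (history- and horizon-dependent) policy `{d_n}`. -/
structure DetPolicy where
  d : (n : ℕ) → ℝ × M.Hist n → A
  measurable_d : ∀ n, Measurable (d n)
  admissible : ∀ (n : ℕ) (s : ℝ) (h : M.Hist n), d n (s, h) ∈ M.act h.2.2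

variable {M}

theorem measurableSet_act [MeasurableSingletonClass A] (x : S) : MeasurableSet (M.act x) :=
  (M.finite_act x).measurableSet

/-- A deterministic policy as a policy: the Dirac measures at `d_n(s, h_n)`. -/
def DetPolicy.toPolicy [MeasurableSingletonClass A] (π : M.DetPolicy) : M.Policy where
  ker n := Kernel.deterministic (π.d n) (π.measurable_d n)
  isMarkovKernel _ := inferInstance
  admissible n s h := by
    rw [Kernel.deterministic_apply' _ _ (measurableSet_act _)]
    simp [π.admissible n s h]

/-- The law of the action of index `n` given the history, when the initial horizon is `s`: the
remaining horizon is `s - S_n`. -/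
def Policy.choose (π : M.Policy) (s : ℝ) (n : ℕ) : Kernel (M.Hist n) A :=
  (π.ker n).comap (fun h => (s - elapsed h, h))
    ((measurable_const.sub (M.measurable_elapsed n).coe_nnreal_real).prodMk measurable_id)

instance isMarkovKernel_choose (π : M.Policy) (s : ℝ) (n : ℕ) : IsMarkovKernel (π.choose s n) := by
  have := π.isMarkovKernel n
  unfold Policy.choose; infer_instance

variable (M) in
/-- Regroups `(t, (x, a))` as `((t, x), a)`, forgetting admissibility. -/
def embed (p : ℝ≥0 × M.Pair) : (ℝ≥0 × S) × A := ((p.1, p.2.1.1), p.2.1.2)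

theorem range_embed : range M.embed = {q | q.2 ∈ M.act q.1.2} := by
  ext q
  constructor
  · rintro ⟨p, rfl⟩; exact p.2.2
  · intro h; exact ⟨(q.1.1, ⟨(q.1.2, q.2), h⟩), rfl⟩

theorem measurableSet_range_embed : MeasurableSet (range M.embed) := by
  rw [range_embed]
  exact M.measurableSet_pairs.preimage
    (f := fun q : (ℝ≥0 × S) × A => (q.1.2, q.2)) (by fun_prop)

theorem measurableEmbedding_embed : MeasurableEmbedding M.embed := by
  have h := (MeasurableEmbedding.id : MeasurableEmbedding (id : ℝ≥0 → ℝ≥0)).prodMap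
    (MeasurableEmbedding.subtype_coe M.measurableSet_pairs)
  exact (MeasurableEquiv.prodAssoc (α := ℝ≥0) (β := S) (γ := A)).symm.measurableEmbedding.comp h

variable (M) in
/-- The history of index `n + 1` made of the past `(t_m, (x_m, a_m))`, `m ≤ n`, and of
`(t_{n+1}, x_{n+1})`. -/
def nextHist (n : ℕ) (q : ((i : Finset.Iic n) → ℝ≥0 × M.Pair) × (ℝ≥0 × S)) : M.Hist (n + 1) :=
  (fun m => (q.1 ⟨m, Finset.mem_Iic.2 (Nat.lt_succ_iff.1 m.2)⟩).2,
    Fin.snoc (fun m : Fin n => (q.1 ⟨m + 1, Finset.mem_Iic.2 m.2⟩).1) q.2.1,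
    q.2.2)

theorem measurable_nextHist (n : ℕ) : Measurable (M.nextHist n) := by
  unfold nextHist
  refine Measurable.prodMk (by fun_prop) (Measurable.prodMk ?_ (by fun_prop))
  refine measurable_pi_lambda _ fun m => ?_
  induction m using Fin.lastCases with
  | last => simp only [Fin.snoc_last]; fun_prop
  | cast m => simp only [Fin.snoc_castSucc]; fun_prop

theorem choose_act (π : M.Policy) (s : ℝ) (n : ℕ) (h : M.Hist n) :
    π.choose s n h (M.act h.2.2) = 1 := by
  unfold Policy.choose
  rw [Kernel.comap_apply]
  exact π.admissible n _ h

variable [StandardBorelSpace S]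

/-- Given the past `(t_m, (x_m, a_m))`, `m ≤ n`: first `(t_{n+1}, x_{n+1})` is drawn from
`Q(dt, dy | x_n, a_n)`, then `a_{n+1}` from the policy, given the remaining horizon and the history. -/
def stepKernel (π : M.Policy) (s : ℝ) (n : ℕ) :
    Kernel ((i : Finset.Iic n) → ℝ≥0 × M.Pair) (ℝ≥0 × M.Pair) :=
  ((M.Q.joint.comap (fun h => (h ⟨n, Finset.mem_Iic.2 le_rfl⟩).2) (by fun_prop)) ⊗ₖ
    ((π.choose s (n + 1)).comap (M.nextHist n) (measurable_nextHist n))).comapRight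
      measurableEmbedding_embed

instance isMarkovKernel_stepKernel (π : M.Policy) (s : ℝ) (n : ℕ) :
    IsMarkovKernel (stepKernel π s n) := by
  refine Kernel.IsMarkovKernel.comapRight _ _ fun h => ?_
  rw [Kernel.compProd_apply measurableSet_range_embed, range_embed]
  have : ∀ b : ℝ≥0 × S, ((π.choose s (n + 1)).comap (M.nextHist n) (measurable_nextHist n)) (h, b)
      (Prod.mk b ⁻¹' {q | q.2 ∈ M.act q.1.2}) = 1 := fun b => by
    rw [Kernel.comap_apply]
    exact choose_act π s (n + 1) (M.nextHist n (h, b))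
  simp_rw [this]
  simp

/-- `t_0 = 0`, `x_0 = x`, and `a_0` is drawn from the policy. -/
def initialLaw (π : M.Policy) (s : ℝ) (x : S) : Measure (ℝ≥0 × M.Pair) :=
  Measure.comap M.embed
    ((Measure.dirac (0, x)).prod (π.choose s 0 (Fin.elim0, Fin.elim0, x)))

instance isProbabilityMeasure_initialLaw (π : M.Policy) (s : ℝ) (x : S) :
    IsProbabilityMeasure (initialLaw π s x) := by
  constructor
  rw [initialLaw, measurableEmbedding_embed.comap_apply, image_univ, range_embed,
    ← range_embed, Measure.dirac_prod, Measure.map_apply (by fun_prop) measurableSet_range_embed,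
    range_embed]
  exact choose_act π s 0 (Fin.elim0, Fin.elim0, x)

/-- The law `P^π_{(s,x)}` of the decision process; the coordinate of index `n` is
`(T_n, (X_n, A_n))`. -/
def pathMeasure (π : M.Policy) (s : ℝ) (x : S) : Measure (MarkedPath M.Pair) :=
  Kernel.trajMeasure (X := fun _ => ℝ≥0 × M.Pair) (initialLaw π s x) (stepKernel π s)

/-- `U^π(s, x)`, the expectation of `∫_0^s c(X(t), A(t)) dt + g(X(s), A(s))`. -/
def expectedCost (π : M.Policy) (s : ℝ≥0) (x : S) : ℝ≥0∞ :=
  ∫⁻ ω, (accumulated M.c s ω + valueAt M.g s ω) ∂(pathMeasure π s x)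

end SMDP

/-! ### The stopping problem as a decision process -/

instance standardBorelSpace_sum_unit (E : Type*) [MeasurableSpace E] [StandardBorelSpace E] :
    StandardBorelSpace (E ⊕ Unit) := by
  let _ := upgradeStandardBorel E
  refine ⟨inferInstance, ⟨?_⟩, inferInstance⟩
  apply le_antisymm
  · intro s hs
    rw [measurableSet_sum_iff] at hs
    have h : s = Sum.inl '' (Sum.inl ⁻¹' s) ∪ Sum.inr '' (Sum.inr ⁻¹' s) := by
      rw [image_preimage_eq_inter_range, image_preimage_eq_inter_range, ← inter_union_distrib_left,
        range_inl_union_range_inr, inter_univ]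
    rw [h]
    borelize (E ⊕ Unit)
    exact (Topology.IsOpenEmbedding.inl.measurableEmbedding.measurableSet_image.2 hs.1).union
      (Topology.IsOpenEmbedding.inr.measurableEmbedding.measurableSet_image.2 hs.2)
  · refine MeasurableSpace.generateFrom_le fun s hs => ?_
    rw [measurableSet_sum_iff]
    exact ⟨(hs.preimage continuous_inl).measurableSet, (hs.preimage continuous_inr).measurableSet⟩

/-- The state space is `E ∪ {Δ}`, with `Δ = inr ()`; action `0` continues and action `1` stops. -/
def stopAct {E : Type*} : E ⊕ Unit → Set (Fin 2)
  | Sum.inl _ => {0, 1}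
  | Sum.inr _ => {1}

theorem one_mem_stopAct {E : Type*} (x : E ⊕ Unit) : (1 : Fin 2) ∈ stopAct x := by
  rcases x with x | x <;> simp [stopAct]

section Stopping

variable {E : Type*} [MeasurableSpace E]

abbrev StopPair (E : Type*) := {p : (E ⊕ Unit) × Fin 2 // p.2 ∈ stopAct p.1}

theorem measurableSet_stopPairs :
    MeasurableSet {p : (E ⊕ Unit) × Fin 2 | p.2 ∈ stopAct p.1} := by
  have h : {p : (E ⊕ Unit) × Fin 2 | p.2 ∈ stopAct p.1} =
      ((range (Sum.inr : Unit → E ⊕ Unit)) ×ˢ {(0 : Fin 2)})ᶜ := by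
    ext ⟨x | x, a⟩ <;> fin_cases a <;> simp [stopAct]
  rw [h]
  exact (measurableSet_range_inr.prod (measurableSet_singleton _)).compl

/-- `Q(t, B ∖ {Δ} | x)` for `x ∈ E` and `a = 0`; `1_{[T+1, ∞)}(t) δ_Δ(B)` for `a = 1`. (The value at
the pair `(Δ, 0)`, which is not admissible, is never used.) -/
def stopLaw (Q : SemiMarkovKernel E E) (T t : ℝ≥0) (p : (E ⊕ Unit) × Fin 2) :
    Measure (E ⊕ Unit) :=
  if p.2 = 0 then Sum.elim (fun x => (Q.law t x).map Sum.inl) (fun _ => 0) p.1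
  else if T + 1 ≤ t then Measure.dirac (Sum.inr ()) else 0

theorem measurable_stopLaw (Q : SemiMarkovKernel E E) (T t : ℝ≥0) :
    Measurable (stopLaw Q T t) := by
  refine Measurable.ite (measurable_snd (measurableSet_singleton _)) ?_ measurable_const
  refine Measurable.comp (g := Sum.elim _ _) ?_ measurable_fst
  exact ((Measure.measurable_map _ measurable_inl).comp (Q.law t).measurable).sumElim
    measurable_const

theorem stopMass_mono (T : ℝ≥0) (B : Set (E ⊕ Unit)) :
    Monotone fun t : ℝ≥0 =>
      (if T + 1 ≤ t then Measure.dirac (Sum.inr () : E ⊕ Unit) else 0) B := by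
  intro t u h
  dsimp only
  by_cases h1 : T + 1 ≤ t
  · rw [if_pos h1, if_pos (h1.trans h)]
  · rw [if_neg h1]; simp

theorem stopMass_rightCts (T : ℝ≥0) (B : Set (E ⊕ Unit)) (t : ℝ≥0) :
    ContinuousWithinAt (fun t : ℝ≥0 =>
      (if T + 1 ≤ t then Measure.dirac (Sum.inr () : E ⊕ Unit) else 0) B) (Ici t) t := by
  refine (tendsto_const_nhds (x := (if T + 1 ≤ t then
    Measure.dirac (Sum.inr () : E ⊕ Unit) else 0) B)).congr' ?_
  by_cases h1 : T + 1 ≤ t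
  · filter_upwards [self_mem_nhdsWithin] with u hu
    rw [if_pos h1, if_pos (h1.trans hu)]
  · filter_upwards [mem_nhdsWithin_of_mem_nhds (Iio_mem_nhds (not_le.1 h1))] with u hu
    rw [if_neg h1, if_neg (not_le.2 hu)]

theorem stopMass_total (T : ℝ≥0) :
    Tendsto (fun t : ℝ≥0 =>
      (if T + 1 ≤ t then Measure.dirac (Sum.inr () : E ⊕ Unit) else 0) univ) atTop (𝓝 1) := by
  refine tendsto_const_nhds.congr' ?_
  filter_upwards [eventually_ge_atTop (T + 1)] with t ht
  simp [ht]

/-- The semi-Markov kernel of the auxiliary decision process. -/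
def stopKernel (Q : SemiMarkovKernel E E) (T : ℝ≥0) :
    SemiMarkovKernel (StopPair E) (E ⊕ Unit) where
  law t := ⟨fun p => stopLaw Q T t p.1, (measurable_stopLaw Q T t).comp measurable_subtype_coe⟩
  mono := by
    rintro ⟨⟨x | x, a⟩, hp⟩ B hB t u htu
    · fin_cases a
      · simpa [stopLaw, Measure.map_apply measurable_inl hB] using
          Q.mono x _ (measurable_inl hB) htu
      · exact stopMass_mono T B htu
    · obtain rfl : a = 1 := hp
      exact stopMass_mono T B htu
  rightCts := by
    rintro ⟨⟨x | x, a⟩, hp⟩ B hB t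
    · fin_cases a
      · simpa [stopLaw, Measure.map_apply measurable_inl hB] using
          Q.rightCts x _ (measurable_inl hB) t
      · exact stopMass_rightCts T B t
    · obtain rfl : a = 1 := hp
      exact stopMass_rightCts T B t
  zero := by
    rintro ⟨⟨x | x, a⟩, hp⟩ B hB
    · fin_cases a
      · simpa [stopLaw, Measure.map_apply measurable_inl hB] using
          Q.zero x _ (measurable_inl hB)
      · simp [stopLaw]
    · obtain rfl : a = 1 := hp
      simp [stopLaw]
  sub := by
    rintro t ⟨⟨x | x, a⟩, hp⟩
    · fin_cases a
      · simpa [stopLaw, Measure.map_apply measurable_inl .univ] using Q.sub t x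
      · by_cases h : T + 1 ≤ t <;> simp [stopLaw, h]
    · obtain rfl : a = 1 := hp
      by_cases h : T + 1 ≤ t <;> simp [stopLaw, h]
  total := by
    rintro ⟨⟨x | x, a⟩, hp⟩
    · fin_cases a
      · simpa [stopLaw, Measure.map_apply measurable_inl .univ] using Q.total x
      · exact stopMass_total T
    · obtain rfl : a = 1 := hp
      exact stopMass_total T

/-- The auxiliary decision process: the cost rate is `c(x)` if `x ∈ E`, `a = 0`, the terminal cost is
`g(x)` if `x ∈ E`, `a = 1`, and both are `0` otherwise. -/
def stoppingSMDP (Q : SemiMarkovKernel E E) (c g : E → ℝ≥0) (hc : Measurable c)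
    (hg : Measurable g) (T : ℝ≥0) : SMDP (E ⊕ Unit) (Fin 2) where
  act := stopAct
  finite_act _ := toFinite _
  measurableSet_pairs := measurableSet_stopPairs
  exists_selector := ⟨fun _ => 1, measurable_const, fun _ x => one_mem_stopAct x⟩
  Q := stopKernel Q T
  c p := if p.1.2 = 0 then Sum.elim c (fun _ => 0) p.1.1 else 0
  g p := if p.1.2 = 1 then Sum.elim g (fun _ => 0) p.1.1 else 0
  measurable_c := by
    refine Measurable.ite (measurableSet_eq_fun (by fun_prop) (by fun_prop)) ?_ measurable_const
    exact (hc.sumElim measurable_const).comp (measurable_fst.comp measurable_subtype_coe)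
  measurable_g := by
    refine Measurable.ite (measurableSet_eq_fun (by fun_prop) (by fun_prop)) ?_ measurable_const
    exact (hg.sumElim measurable_const).comp (measurable_fst.comp measurable_subtype_coe)

variable {Q : SemiMarkovKernel E E} {c g : E → ℝ≥0} {hc : Measurable c} {hg : Measurable g}
  {T : ℝ≥0}

/-- The history `(x_0, 0, t_1, x_1, …, 0, t_n, x_n)` with all actions `0`, made of a history
`(x_0, t_1, x_1, …, t_n, x_n)` of the semi-Markov process. -/
def continueHist (Q : SemiMarkovKernel E E) (c g : E → ℝ≥0) (hc : Measurable c)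
    (hg : Measurable g) (T : ℝ≥0) {n : ℕ} (h : (Fin n → E) × (Fin n → ℝ≥0) × E) :
    (stoppingSMDP Q c g hc hg T).Hist n :=
  (fun m => ⟨(Sum.inl (h.1 m), 0), Or.inl rfl⟩, h.2.1, Sum.inl h.2.2)

theorem measurable_continueHist (n : ℕ) :
    Measurable (continueHist Q c g hc hg T (n := n)) := by
  refine Measurable.prodMk ?_ (Measurable.prodMk (by fun_prop) (by fun_prop))
  refine measurable_pi_lambda _ fun m => Measurable.subtype_mk ?_
  exact (measurable_inl.comp (by fun_prop)).prodMk measurable_const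

/-- The deterministic policies that continue when the remaining horizon is exactly `0` and the history
has states in `E` and actions `0` only. -/
def continuingAtZero (Q : SemiMarkovKernel E E) (c g : E → ℝ≥0) (hc : Measurable c)
    (hg : Measurable g) (T : ℝ≥0) : Set (stoppingSMDP Q c g hc hg T).DetPolicy :=
  {π | ∀ (n : ℕ) (h : (Fin n → E) × (Fin n → ℝ≥0) × E),
    π.d n (0, continueHist Q c g hc hg T h) = 0}

/-- The history `(X_0, T_1, X_1, …, T_n, X_n)` of the semi-Markov process. -/
def jumpHist (n : ℕ) (ω : MarkedPath E) : (Fin n → E) × (Fin n → ℝ≥0) × E :=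
  (fun m => mark m ω, fun m => sojourn (m + 1) ω, mark n ω)

theorem measurable_jumpHist (n : ℕ) : Measurable[filtration E n] (jumpHist (E := E) n) := by
  refine Measurable.prodMk ?_ (Measurable.prodMk ?_ (measurable_mark_filtration le_rfl))
  · exact @measurable_pi_lambda _ _ _ (filtration E n) _ _ fun m => measurable_mark_filtration m.2.le
  · exact @measurable_pi_lambda _ _ _ (filtration E n) _ _ fun m => measurable_sojourn_filtration m.2

/-- The first `n` at which the policy, with initial horizon `s`, stops along the path on which it has
continued so far; `∞` if there is none. -/
def inducedTime (π : (stoppingSMDP Q c g hc hg T).DetPolicy) (s : ℝ) (ω : MarkedPath E) : ℕ∞ :=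
  sInf ((fun n : ℕ => (n : ℕ∞)) ''
    {n | π.d n (s - jumpTime n ω, continueHist Q c g hc hg T (jumpHist n ω)) = 1})

theorem isStoppingTime_inducedTime (π : (stoppingSMDP Q c g hc hg T).DetPolicy) (s : ℝ) :
    IsStoppingTime (filtration E) (inducedTime π s) := by
  intro n
  have h : {ω | inducedTime π s ω ≤ (n : ℕ∞)} = ⋃ k ≤ n,
      {ω | π.d k (s - jumpTime k ω, continueHist Q c g hc hg T (jumpHist k ω)) = 1} := by
    ext ω
    simp only [mem_ofPred_eq, mem_iUnion, exists_prop]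
    constructor
    · intro hle
      have hne : ((fun n : ℕ => (n : ℕ∞)) '' {n | π.d n (s - jumpTime n ω,
          continueHist Q c g hc hg T (jumpHist n ω)) = 1}).Nonempty := by
        by_contra hemp
        rw [not_nonempty_iff_eq_empty] at hemp
        rw [inducedTime, hemp, sInf_empty] at hle
        exact absurd (top_le_iff.1 hle) (ENat.natCast_ne_top n)
      obtain ⟨k, hk, hk'⟩ := csInf_mem hne
      refine ⟨k, ?_, hk⟩
      have : ((k : ℕ) : ℕ∞) ≤ n := hk'.le.trans hle
      exact_mod_cast this
    · rintro ⟨k, hk, h1⟩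
      refine (sInf_le (mem_image_of_mem (fun n : ℕ => (n : ℕ∞)) h1)).trans ?_
      exact Nat.cast_le.2 hk
  change MeasurableSet[filtration E n] {ω | inducedTime π s ω ≤ (n : ℕ∞)}
  rw [h]
  refine MeasurableSet.iUnion fun k => MeasurableSet.iUnion fun hk => ?_
  have hm : Measurable[filtration E n] fun ω : MarkedPath E =>
      π.d k (s - jumpTime k ω, continueHist Q c g hc hg T (jumpHist k ω)) := by
    refine (π.measurable_d k).comp (Measurable.prodMk ?_ ?_)
    · exact measurable_const.sub
        (measurable_coe_nnreal_real.comp (measurable_jumpTime_filtration hk))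
    · exact (measurable_continueHist k).comp
        ((measurable_jumpHist k).mono ((filtration E).mono hk) le_rfl)
  exact hm (measurableSet_singleton 1)

/-- The stopping time `τ_π^s` induced by the policy `π` and the horizon `s`. -/
def inducedStoppingTime (π : (stoppingSMDP Q c g hc hg T).DetPolicy) (s : ℝ) : StoppingTime E :=
  ⟨inducedTime π s, isStoppingTime_inducedTime π s⟩

end Stopping
end

/-!
The proof is a coupling. A path `ω = (T_n, X_n)` of the semi-Markov process drives a path of the
decision process, `controlledPath π s ω`: it takes the sojourn times and states of `ω` with the
actions of the policy, up to and including the first jump `τ` at which the policy stops, and then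
jumps to `Δ` again and again, with sojourn times `T + 1`. This map depends on the past only and
carries the transition kernels of the semi-Markov process to those of the decision process. Indeed,
after action `0` the decision process moves according to `Q`, and after action `1` its next step is
almost surely `(T + 1, Δ)`. By uniqueness of the measure in the Ionescu-Tulcea theorem
(`map_trajMeasure`), the image of `smpMeasure Q x` is the law of the decision process
(`map_controlledPath_smpMeasure`).

It remains to compare the costs on a path all of whose sojourn times are positive, which holds almost
surely since `Q(0, · | x) = 0` (`cost_controlledPath`). Up to the time `S_τ` both problems pay the
cost rate `c(X(t))`. If `S_τ < s`, the decision process has action `1` in state `X_τ` on all of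
`[S_τ, s]`, because the next step lasts `T + 1 > s`: it pays nothing more on the way and `g(X_τ)` at
time `s`. The case `S_τ = s` does not occur, since the policy continues when the remaining horizon
is `0`; and if `S_τ > s`, the action at time `s` is `0` and there is no terminal cost. At and after
an accumulation point of the jump times, all costs vanish in both problems.
-/

noncomputable section

open MarkedPath

/-! ### Images of Ionescu-Tulcea measures under adapted maps -/

section Trajectory

open Preorder

variable {X Y : Type*}

/-- Extends a history `(x_0, …, x_n)` to a path, by repeating `x_n`. -/
def extendHist (n : ℕ) (h : (i : Finset.Iic n) → X) (k : ℕ) : X :=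
  h ⟨min k n, Finset.mem_Iic.2 (min_le_right k n)⟩

theorem extendHist_frestrictLe {n k : ℕ} (h : k ≤ n) (ω : ℕ → X) :
    extendHist n (frestrictLe (π := fun _ => X) n ω) k = ω k := by
  simp [extendHist, frestrictLe, min_eq_left h]

theorem frestrictLe_extendHist (n : ℕ) (h : (i : Finset.Iic n) → X) :
    frestrictLe (π := fun _ => X) n (extendHist n h) = h := by
  ext i
  have hi := Finset.mem_Iic.1 i.2
  simp only [extendHist, frestrictLe_apply]
  congr 1
  exact Subtype.ext (min_eq_left hi)

variable [MeasurableSpace X] [MeasurableSpace Y]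

/-- A measure on paths is determined by the laws of the initial segments. -/
theorem measure_ext_of_map_frestrictLe {μ ν : Measure (ℕ → X)} [IsFiniteMeasure ν]
    (h : ∀ n : ℕ, μ.map (frestrictLe (π := fun _ => X) n) =
      ν.map (frestrictLe (π := fun _ => X) n)) : μ = ν := by
  refine IsProjectiveLimit.unique (α := fun _ : ℕ => X) (P := fun I => ν.map I.restrict)
    (fun I => ?_) (fun _ => rfl)
  have hI := I.subset_Iic_sup_id
  have hm : Measurable (Finset.restrict₂ (π := fun _ : ℕ => X) hI) :=
    Finset.measurable_restrict₂ hI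
  change μ.map I.restrict = ν.map I.restrict
  rw [← Finset.restrict₂_comp_restrict hI, ← Measure.map_map hm (by fun_prop),
    ← Measure.map_map hm (by fun_prop)]
  exact congrArg _ (h _)

theorem map_frestrictLe_zero_trajMeasure (μ₀ : Measure X)
    (κ : (n : ℕ) → Kernel ((i : Finset.Iic n) → X) X) [∀ n, IsMarkovKernel (κ n)] :
    (Kernel.trajMeasure (X := fun _ => X) μ₀ κ).map (frestrictLe 0) =
      μ₀.map fun x _ => x := by
  rw [Kernel.trajMeasure, Measure.map_comp _ _ (by fun_prop), Kernel.traj_map_frestrictLe,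
    Kernel.partialTraj_self, Measure.id_comp]
  rfl

theorem measurable_extendHist (n : ℕ) :
    Measurable (extendHist n : ((i : Finset.Iic n) → X) → ℕ → X) := by
  unfold extendHist; fun_prop

/-- An adapted map `Φ` of paths which transforms the transition kernels `κ` into the transition
kernels `η` transforms the law of the trajectory accordingly. -/
theorem map_trajMeasure {μ₀ : Measure X} [IsProbabilityMeasure μ₀] {ν₀ : Measure Y}
    [IsProbabilityMeasure ν₀]
    {κ : (n : ℕ) → Kernel ((i : Finset.Iic n) → X) X} [∀ n, IsMarkovKernel (κ n)]
    {η : (n : ℕ) → Kernel ((i : Finset.Iic n) → Y) Y} [∀ n, IsMarkovKernel (η n)]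
    {Φ : (ℕ → X) → ℕ → Y} (hΦ : Measurable Φ)
    (hadapted : ∀ (n : ℕ) (ω ω' : ℕ → X), (∀ k ≤ n, ω k = ω' k) → Φ ω n = Φ ω' n)
    (hinit : μ₀.map (fun x => Φ (fun _ => x) 0) = ν₀)
    (hstep : ∀ (n : ℕ) (ω : ℕ → X),
      (κ n (frestrictLe n ω)).map (fun x => Φ (Function.update ω (n + 1) x) (n + 1)) =
        η n (frestrictLe n (Φ ω))) :
    (Kernel.trajMeasure (X := fun _ => X) μ₀ κ).map Φ =
      Kernel.trajMeasure (X := fun _ => Y) ν₀ η := by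
  set μ := Kernel.trajMeasure (X := fun _ => X) μ₀ κ with hμ
  set ν := Kernel.trajMeasure (X := fun _ => Y) ν₀ η with hν
  have hΦn : ∀ n, Measurable fun ω => Φ ω n := fun n => (measurable_pi_apply n).comp hΦ
  have hrestr : ∀ n (ω ω' : ℕ → X), (∀ k ≤ n, ω k = ω' k) →
      frestrictLe (π := fun _ => Y) n (Φ ω) = frestrictLe (π := fun _ => Y) n (Φ ω') := by
    intro n ω ω' h
    ext i
    have hi := Finset.mem_Iic.1 i.2
    exact hadapted _ _ _ fun k hk => h k (hk.trans hi)
  -- the pair (past, next coordinate) of `Φ ω` has the law prescribed by `η`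
  have hpair : ∀ n, ((μ.map Φ).map (frestrictLe (π := fun _ => Y) n)) ⊗ₘ η n =
      (μ.map Φ).map fun y => (frestrictLe (π := fun _ => Y) n y, y (n + 1)) := by
    intro n
    -- by adaptedness, `Φ ω` up to `n` and `Φ ω (n + 1)` are functions of `ω` up to `n` and of
    -- `ω (n + 1)`; they are obtained by extending the history to a path
    let p : ((i : Finset.Iic n) → X) → (i : Finset.Iic n) → Y :=
      fun h => frestrictLe (π := fun _ => Y) n (Φ (extendHist n h))
    let q : ((i : Finset.Iic n) → X) → X → Y :=
      fun h x => Φ (Function.update (extendHist n h) (n + 1) x) (n + 1)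
    have hp : Measurable p := by
      exact (measurable_frestrictLe n).comp (hΦ.comp (measurable_extendHist n))
    have hq : Measurable fun z : ((i : Finset.Iic n) → X) × X => q z.1 z.2 := by
      refine (hΦn (n + 1)).comp ?_
      refine measurable_pi_lambda _ fun k => ?_
      by_cases hk : k = n + 1
      · subst hk; simpa using measurable_snd
      · simp only [Function.update_of_ne hk]
        exact (measurable_pi_apply k).comp ((measurable_extendHist n).comp measurable_fst)
    have hpω : ∀ ω, frestrictLe (π := fun _ => Y) n (Φ ω) =
        p (frestrictLe (π := fun _ => X) n ω) := fun ω =>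
      hrestr n _ _ fun k hk => (extendHist_frestrictLe hk ω).symm
    have hqω : ∀ ω, Φ ω (n + 1) = q (frestrictLe (π := fun _ => X) n ω) (ω (n + 1)) := by
      intro ω
      refine hadapted _ _ _ fun k hk => ?_
      rcases hk.lt_or_eq with hk | rfl
      · rw [Function.update_of_ne hk.ne, extendHist_frestrictLe (Nat.lt_succ_iff.1 hk)]
      · simp
    have hM := Kernel.map_frestrictLe_trajMeasure_compProd_eq_map_trajMeasure
      (X := fun _ => X) (κ := κ) (μ₀ := μ₀) (a := n)
    rw [← hμ] at hM
    refine Measure.ext fun s hs => ?_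
    have hR : (μ.map Φ).map (fun y => (frestrictLe (π := fun _ => Y) n y, y (n + 1))) =
        ((μ.map (frestrictLe (π := fun _ => X) n)) ⊗ₘ κ n).map
          fun z => (p z.1, q z.1 z.2) := by
      rw [hM, Measure.map_map (by fun_prop) hΦ, Measure.map_map (by fun_prop) (by fun_prop)]
      congr 1
      ext1 ω
      exact Prod.ext (hpω ω) (hqω ω)
    have hL : (μ.map Φ).map (frestrictLe (π := fun _ => Y) n) =
        (μ.map (frestrictLe (π := fun _ => X) n)).map p := by
      rw [Measure.map_map (by fun_prop) hΦ, Measure.map_map hp (by fun_prop)]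
      congr 1
      ext1 ω
      exact hpω ω
    have hpq : Measurable fun z : ((i : Finset.Iic n) → X) × X => (p z.1, q z.1 z.2) := by
      fun_prop
    have hm : IsProbabilityMeasure (μ.map (frestrictLe (π := fun _ => X) n)) :=
      Measure.isProbabilityMeasure_map (by fun_prop)
    have hm' : IsProbabilityMeasure ((μ.map (frestrictLe (π := fun _ => X) n)).map p) :=
      Measure.isProbabilityMeasure_map (by fun_prop)
    rw [hR, hL, Measure.compProd_apply hs,
      lintegral_map (Kernel.measurable_kernel_prodMk_left hs) hp,
      Measure.map_apply hpq hs, Measure.compProd_apply (hpq hs)]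
    refine lintegral_congr fun h => ?_
    have hst := hstep n (extendHist n h)
    rw [frestrictLe_extendHist] at hst
    change η n (frestrictLe n (Φ (extendHist n h))) _ = _
    rw [← hst, Measure.map_apply (by exact hq.comp measurable_prodMk_left)
      (measurable_prodMk_left hs)]
    rfl
  refine measure_ext_of_map_frestrictLe fun n => ?_
  induction n with
  | zero =>
    have hΦ0 : Measurable fun x => Φ (fun _ => x) 0 :=
      (hΦn 0).comp (measurable_pi_lambda _ fun _ => measurable_id)
    have hcX : Measurable fun (x : X) (_ : Finset.Iic 0) => x :=
      measurable_pi_lambda _ fun _ => measurable_id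
    have hc : Measurable fun (y : Y) (_ : Finset.Iic 0) => y :=
      measurable_pi_lambda _ fun _ => measurable_id
    rw [hν, map_frestrictLe_zero_trajMeasure, ← hinit, Measure.map_map (by fun_prop) hΦ,
      Measure.map_map hc hΦ0]
    have : (frestrictLe (π := fun _ => Y) 0) ∘ Φ =
        (fun h : (i : Finset.Iic 0) → X => frestrictLe (π := fun _ => Y) 0
          (Φ (extendHist 0 h))) ∘ frestrictLe (π := fun _ => X) 0 := by
      ext1 ω
      exact hrestr 0 _ _ fun k hk => (extendHist_frestrictLe hk ω).symm
    have hg : Measurable fun h : (i : Finset.Iic 0) → X =>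
        frestrictLe (π := fun _ => Y) 0 (Φ (extendHist 0 h)) :=
      (measurable_frestrictLe 0).comp (hΦ.comp (measurable_extendHist 0))
    rw [this, ← Measure.map_map hg (by fun_prop), hμ, map_frestrictLe_zero_trajMeasure,
      Measure.map_map hg hcX]
    congr 1
    ext x i
    obtain ⟨i, hi⟩ := i
    obtain rfl : i = 0 := by simpa using hi
    rfl
  | succ n ih =>
    let e : ((i : Finset.Iic n) → Y) × Y → (i : Finset.Iic (n + 1)) → Y := fun z i =>
      Function.update (extendHist n z.1) (n + 1) z.2 i
    have he : Measurable e := by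
      refine measurable_pi_lambda _ fun i => ?_
      by_cases hk : (i : ℕ) = n + 1
      · simp only [e, hk, Function.update_self]; exact measurable_snd
      · simp only [e, Function.update_of_ne hk]
        exact (measurable_pi_apply (i : ℕ)).comp
          (g := fun y : ℕ → Y => y i) ((measurable_extendHist n).comp measurable_fst)
    have hcomp : (frestrictLe (π := fun _ => Y) (n + 1)) =
        e ∘ fun y => (frestrictLe (π := fun _ => Y) n y, y (n + 1)) := by
      ext y i
      have hi := Finset.mem_Iic.1 i.2
      by_cases hk : (i : ℕ) = n + 1
      · simp [e, hk]
      · simp only [e, Function.comp, Function.update_of_ne hk]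
        rw [extendHist_frestrictLe (by omega)]
        rfl
    have hN := Kernel.map_frestrictLe_trajMeasure_compProd_eq_map_trajMeasure
      (X := fun _ => Y) (κ := η) (μ₀ := ν₀) (a := n)
    rw [← hν] at hN
    rw [hcomp, ← Measure.map_map he (by fun_prop), ← Measure.map_map he (by fun_prop),
      ← hpair n, ← hN, ih]

end Trajectory

/-! ### Costs along a path -/

namespace MarkedPath

section

variable {X : Type*}

theorem jumpTime_succ (n : ℕ) (ω : MarkedPath X) :
    jumpTime (n + 1) ω = jumpTime n ω + sojourn (n + 1) ω := by
  rw [jumpTime, Finset.sum_range_succ, jumpTime]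

theorem jumpTime_zero (ω : MarkedPath X) : jumpTime 0 ω = 0 := by
  simp [jumpTime, sojourn]

theorem jumpTime_mono (ω : MarkedPath X) : Monotone fun n => jumpTime n ω :=
  monotone_nat_of_le_succ fun n => by rw [jumpTime_succ]; exact le_self_add

theorem atTime_of_mem {ω : MarkedPath X} {t : ℝ} {n : ℕ} (h1 : (jumpTime n ω : ℝ) ≤ t)
    (h2 : t < jumpTime (n + 1) ω) : atTime t ω = some (mark n ω) := by
  classical
  have h : ∃ n, (jumpTime n ω : ℝ) ≤ t ∧ t < jumpTime (n + 1) ω := ⟨n, h1, h2⟩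
  have hn : Nat.find h = n := by
    refine le_antisymm (Nat.find_min' h ⟨h1, h2⟩) ?_
    by_contra! hlt
    have h3 : jumpTime (Nat.find h + 1) ω ≤ jumpTime n ω := jumpTime_mono ω hlt
    have h4 := (Nat.find_spec h).2
    exact absurd (h4.trans_le ((NNReal.coe_le_coe.2 h3).trans h1)) (lt_irrefl _)
  rw [atTime, dif_pos h]
  exact congrArg (fun k => some (mark k ω)) hn

theorem valueAt_of_mem (f : X → ℝ≥0) {ω : MarkedPath X} {t : ℝ} {n : ℕ}
    (h1 : (jumpTime n ω : ℝ) ≤ t) (h2 : t < jumpTime (n + 1) ω) :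
    valueAt f t ω = f (mark n ω) := by
  rw [valueAt, atTime_of_mem h1 h2]; rfl

theorem valueAt_of_forall (f : X → ℝ≥0) {ω : MarkedPath X} {t : ℝ}
    (h : ∀ n, (jumpTime n ω : ℝ) ≤ t → (jumpTime (n + 1) ω : ℝ) ≤ t) :
    valueAt f t ω = 0 := by
  have : ¬ ∃ n, (jumpTime n ω : ℝ) ≤ t ∧ t < jumpTime (n + 1) ω := by
    rintro ⟨n, h1, h2⟩
    exact absurd (h n h1) (not_le.2 h2)
  rw [valueAt, atTime, dif_neg this]; rfl

/-- The intervals `[S_n, S_{n+1})` are disjoint, so at most one term of the sum is nonzero. -/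
theorem valueAt_eq_tsum (f : X → ℝ≥0) (t : ℝ) (ω : MarkedPath X) :
    valueAt f t ω = ∑' n, {p : ℝ × MarkedPath X | (jumpTime n p.2 : ℝ) ≤ p.1 ∧
      p.1 < jumpTime (n + 1) p.2}.indicator (fun p => (f (mark n p.2) : ℝ≥0∞)) (t, ω) := by
  by_cases h : ∃ n, (jumpTime n ω : ℝ) ≤ t ∧ t < jumpTime (n + 1) ω
  · obtain ⟨n, h1, h2⟩ := h
    rw [valueAt_of_mem f h1 h2, tsum_eq_single n]
    · rw [indicator_of_mem (by exact ⟨h1, h2⟩)]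
    · intro m hm
      refine indicator_of_notMem ?_ _
      rintro ⟨h3, h4⟩
      dsimp only at h3 h4
      rcases hm.lt_or_gt with h | h
      · have h5 : jumpTime (m + 1) ω ≤ jumpTime n ω := jumpTime_mono ω h
        have := NNReal.coe_le_coe.2 h5
        linarith
      · have h5 : jumpTime (n + 1) ω ≤ jumpTime m ω := jumpTime_mono ω h
        have := NNReal.coe_le_coe.2 h5
        linarith
  · push Not at h
    rw [valueAt_of_forall f h, eq_comm, ENNReal.tsum_eq_zero]
    intro n
    refine indicator_of_notMem ?_ _
    rintro ⟨h3, h4⟩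
    exact absurd (h n h3) (not_le.2 h4)

end

variable {X : Type*} [MeasurableSpace X]

theorem measurable_jumpTime (n : ℕ) : Measurable (jumpTime n : MarkedPath X → ℝ≥0) :=
  (measurable_jumpTime_filtration le_rfl).mono ((filtration X).le n) le_rfl

theorem measurable_valueAt_prod {f : X → ℝ≥0} (hf : Measurable f) :
    Measurable fun p : ℝ × MarkedPath X => valueAt f p.1 p.2 := by
  simp_rw [valueAt_eq_tsum]
  refine Measurable.tsum fun n => ?_
  have hj : ∀ n, Measurable fun p : ℝ × MarkedPath X => (jumpTime n p.2 : ℝ) := fun n =>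
    ((measurable_jumpTime n).comp measurable_snd).coe_nnreal_real
  refine Measurable.indicator ?_ ((measurableSet_le (hj n) measurable_fst).inter
    (measurableSet_lt measurable_fst (hj (n + 1))))
  exact (hf.comp ((measurable_mark n).comp measurable_snd)).coe_nnreal_ennreal

theorem measurable_valueAt {f : X → ℝ≥0} (hf : Measurable f) (t : ℝ) :
    Measurable (valueAt f t) :=
  (measurable_valueAt_prod hf).comp measurable_prodMk_left

theorem measurable_accumulated {f : X → ℝ≥0} (hf : Measurable f) (u : ℝ) :
    Measurable (accumulated f u) :=
  ((measurable_valueAt_prod hf).comp measurable_swap).lintegral_prod_right'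

end MarkedPath

/-! ### Sojourn laws -/

namespace SemiMarkovKernel

variable {α β : Type*} [MeasurableSpace α] [MeasurableSpace β] (Q : SemiMarkovKernel α β)
  [MeasurableSpace.CountablyGenerated β]

/-- The joint law of sojourn time and next state is determined by `Q`, since the rectangles
`[0, t] × B` form a generating π-system. -/
theorem joint_eq_of_apply_Iic_prod {x : α} {μ : Measure (ℝ≥0 × β)}
    (h : ∀ (t : ℝ≥0) (B : Set β), MeasurableSet B → μ (Iic t ×ˢ B) = Q.law t x B) :
    Q.joint x = μ := by
  refine Measure.ext_prod fun {s B} hs hB => ?_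
  -- for fixed `B`, both sides are measures in the time variable with the same values on `[0, t]`
  have key : ((Q.joint x).restrict (univ ×ˢ B)).map Prod.fst =
      (μ.restrict (univ ×ˢ B)).map Prod.fst := by
    refine Measure.ext_of_Iic _ _ fun t => ?_
    rw [Measure.map_apply measurable_fst measurableSet_Iic,
      Measure.map_apply measurable_fst measurableSet_Iic,
      Measure.restrict_apply (measurable_fst measurableSet_Iic),
      Measure.restrict_apply (measurable_fst measurableSet_Iic), ← prod_univ, prod_inter_prod,
      inter_univ, univ_inter, Q.joint_apply x t hB, h t B hB]
  have := congrArg (fun ν => ν s) key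
  rwa [Measure.map_apply measurable_fst hs, Measure.map_apply measurable_fst hs,
    Measure.restrict_apply (measurable_fst hs), Measure.restrict_apply (measurable_fst hs),
    ← prod_univ, prod_inter_prod, inter_univ, univ_inter] at this

theorem joint_singleton_zero_prod (x : α) : Q.joint x ({0} ×ˢ univ) = 0 := by
  have : ({0} : Set ℝ≥0) = Iic 0 := by ext t; simp
  rw [this, Q.joint_apply x 0 .univ, Q.zero x _ .univ]

end SemiMarkovKernel

section SMP

variable {E : Type*} [MeasurableSpace E] [StandardBorelSpace E]

theorem ae_sojourn_pos (Q : SemiMarkovKernel E E) (x : E) :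
    ∀ᵐ ω ∂(smpMeasure Q x), ∀ n, 0 < sojourn (n + 1) ω := by
  refine ae_all_iff.2 fun n => ?_
  have hM := Kernel.map_frestrictLe_trajMeasure_compProd_eq_map_trajMeasure
      (X := fun _ => ℝ≥0 × E) (κ := fun n => Q.joint.comap
        (fun h : (i : Finset.Iic n) → ℝ≥0 × E => (h ⟨n, Finset.mem_Iic.2 le_rfl⟩).2)
        (by fun_prop)) (μ₀ := Measure.dirac (0, x)) (a := n)
  have hs : MeasurableSet ((univ : Set ((i : Finset.Iic n) → ℝ≥0 × E)) ×ˢ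
      (({0} : Set ℝ≥0) ×ˢ (univ : Set E))) :=
    MeasurableSet.univ.prod ((measurableSet_singleton 0).prod .univ)
  have h := congrArg (fun ν => ν (univ ×ˢ ({0} ×ˢ univ))) hM
  rw [Measure.map_apply (by fun_prop) hs, Measure.compProd_apply hs] at h
  have h0 : ∀ a : (i : Finset.Iic n) → ℝ≥0 × E,
      (Q.joint.comap (fun h : (i : Finset.Iic n) → ℝ≥0 × E =>
        (h ⟨n, Finset.mem_Iic.2 le_rfl⟩).2) (by fun_prop)) a
        (Prod.mk a ⁻¹' (univ ×ˢ ({0} ×ˢ univ))) = 0 := by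
    intro a
    rw [Kernel.comap_apply, mk_preimage_prod_right (mem_univ a)]
    exact Q.joint_singleton_zero_prod _
  simp_rw [h0] at h
  rw [lintegral_zero] at h
  refine measure_mono_null (fun ω hω => ?_) h.symm
  have : (ω (n + 1)).1 = 0 := by
    simpa [sojourn] using hω
  simp [this]

end SMP

/-! ### Transitions under a deterministic policy -/

namespace SMDP

variable {S A : Type*} [MeasurableSpace S] [MeasurableSpace A] [MeasurableSingletonClass A]
  {M : SMDP S A}

/-- The action chosen by the deterministic policy `π` on the history `h`, when the initial horizon
is `s`. -/
def DetPolicy.action (π : M.DetPolicy) (s : ℝ) {n : ℕ} (h : M.Hist n) : A :=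
  π.d n (s - elapsed h, h)

omit [MeasurableSingletonClass A] in
theorem DetPolicy.action_mem (π : M.DetPolicy) (s : ℝ) {n : ℕ} (h : M.Hist n) :
    π.action s h ∈ M.act h.2.2 :=
  π.admissible n _ h

omit [MeasurableSingletonClass A] in
theorem DetPolicy.measurable_action (π : M.DetPolicy) (s : ℝ) (n : ℕ) :
    Measurable (π.action s : M.Hist n → A) :=
  (π.measurable_d n).comp
    ((measurable_const.sub (M.measurable_elapsed n).coe_nnreal_real).prodMk measurable_id)

theorem DetPolicy.choose_toPolicy (π : M.DetPolicy) (s : ℝ) (n : ℕ) (h : M.Hist n) :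
    π.toPolicy.choose s n h = Measure.dirac (π.action s h) := by
  rw [Policy.choose, Kernel.comap_apply]
  exact Kernel.deterministic_apply (π.measurable_d n) _

/-- The transition from the past `h` to the sojourn time and next state `q`, completed by the
action of the policy. -/
def DetPolicy.transition (π : M.DetPolicy) (s : ℝ) {n : ℕ}
    (h : (i : Finset.Iic n) → ℝ≥0 × M.Pair) (q : ℝ≥0 × S) : ℝ≥0 × M.Pair :=
  (q.1, ⟨(q.2, π.action s (M.nextHist n (h, q))), π.action_mem s (M.nextHist n (h, q))⟩)

omit [MeasurableSingletonClass A] in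
theorem DetPolicy.measurable_transition (π : M.DetPolicy) (s : ℝ) {n : ℕ}
    (h : (i : Finset.Iic n) → ℝ≥0 × M.Pair) : Measurable (π.transition s h) :=
  measurable_fst.prodMk (Measurable.subtype_mk (measurable_snd.prodMk
    ((π.measurable_action s (n + 1)).comp
      ((M.measurable_nextHist n).comp measurable_prodMk_left))))

variable [StandardBorelSpace S]

theorem DetPolicy.stepKernel_toPolicy (π : M.DetPolicy) (s : ℝ) (n : ℕ)
    (h : (i : Finset.Iic n) → ℝ≥0 × M.Pair) :
    stepKernel π.toPolicy s n h =
      (M.Q.joint (h ⟨n, Finset.mem_Iic.2 le_rfl⟩).2).map (π.transition s h) := by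
  refine Measure.ext fun B hB => ?_
  have hB' := M.measurableEmbedding_embed.measurableSet_image.2 hB
  rw [stepKernel, Kernel.comapRight_apply' _ _ _ hB, Kernel.compProd_apply hB', Kernel.comap_apply,
    Measure.map_apply (π.measurable_transition s h) hB,
    ← lintegral_indicator_one (π.measurable_transition s h hB)]
  refine lintegral_congr fun q => ?_
  rw [Kernel.comap_apply, DetPolicy.choose_toPolicy,
    Measure.dirac_apply' _ (measurable_prodMk_left hB')]
  have hiff : π.action s (M.nextHist n (h, q)) ∈ Prod.mk q ⁻¹' (M.embed '' B) ↔
      q ∈ π.transition s h ⁻¹' B :=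
    M.measurableEmbedding_embed.injective.mem_set_image (a := π.transition s h q)
  by_cases hq : q ∈ π.transition s h ⁻¹' B
  · rw [indicator_of_mem hq, indicator_of_mem (hiff.2 hq)]; rfl
  · rw [indicator_of_notMem hq, indicator_of_notMem (mt hiff.1 hq)]

omit [StandardBorelSpace S] in
theorem DetPolicy.initialLaw_toPolicy (π : M.DetPolicy) (s : ℝ) (x : S) :
    initialLaw π.toPolicy s x = Measure.dirac
      (0, ⟨(x, π.action s (n := 0) (Fin.elim0, Fin.elim0, x)),
        π.action_mem s (n := 0) (Fin.elim0, Fin.elim0, x)⟩) := by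
  refine Measure.ext fun B hB => ?_
  have hB' := M.measurableEmbedding_embed.measurableSet_image.2 hB
  rw [initialLaw, M.measurableEmbedding_embed.comap_apply, DetPolicy.choose_toPolicy,
    Measure.dirac_prod_dirac, Measure.dirac_apply' _ hB', Measure.dirac_apply' _ hB]
  exact indicator_eq_indicator (M.measurableEmbedding_embed.injective.mem_set_image (a :=
    ((0, ⟨(x, π.action s (n := 0) (Fin.elim0, Fin.elim0, x)),
      π.action_mem s (n := 0) (Fin.elim0, Fin.elim0, x)⟩) :
      ℝ≥0 × M.Pair))) rfl

end SMDP

section Stopping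

variable {E : Type*} [MeasurableSpace E]

theorem joint_stopKernel_continue [StandardBorelSpace E] (Q : SemiMarkovKernel E E) (T : ℝ≥0)
    (x : E) :
    (stopKernel Q T).joint ⟨(Sum.inl x, 0), Or.inl rfl⟩ =
      (Q.joint x).map fun p => (p.1, Sum.inl p.2) := by
  refine SemiMarkovKernel.joint_eq_of_apply_Iic_prod _ fun t B hB => ?_
  have hm : Measurable fun p : ℝ≥0 × E => (p.1, (Sum.inl p.2 : E ⊕ Unit)) :=
    measurable_fst.prodMk (measurable_inl.comp measurable_snd)
  rw [Measure.map_apply hm (measurableSet_Iic.prod hB)]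
  change Q.joint x (Iic t ×ˢ (Sum.inl ⁻¹' B)) = ((Q.law t x).map Sum.inl) B
  rw [Q.joint_apply x t (measurable_inl hB), Measure.map_apply measurable_inl hB]

theorem joint_stopKernel_stop [StandardBorelSpace E] (Q : SemiMarkovKernel E E) (T : ℝ≥0)
    {p : StopPair E} (hp : p.1.2 = 1) :
    (stopKernel Q T).joint p = Measure.dirac (T + 1, Sum.inr ()) := by
  refine SemiMarkovKernel.joint_eq_of_apply_Iic_prod _ fun t B hB => ?_
  rw [Measure.dirac_apply' _ (measurableSet_Iic.prod hB)]
  have hlaw : (stopKernel Q T).law t p =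
      if T + 1 ≤ t then Measure.dirac (Sum.inr ()) else 0 := by
    change stopLaw Q T t p.1 = _
    rw [stopLaw, if_neg (by simp [hp])]
  rw [hlaw]
  by_cases h1 : T + 1 ≤ t
  · rw [if_pos h1, Measure.dirac_apply' _ hB]
    exact indicator_eq_indicator (by simp [h1]) rfl
  · rw [if_neg h1, indicator_of_notMem (by simp [h1])]; rfl

/-! ### The controlled path driven by a path of the semi-Markov process -/

variable {Q : SemiMarkovKernel E E} {c g : E → ℝ≥0} {hc : Measurable c} {hg : Measurable g}
  {T : ℝ≥0}

/-- The admissible pair of the state `x ∈ E` and the action `a`. -/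
def statePair (x : E) (a : Fin 2) : (stoppingSMDP Q c g hc hg T).Pair :=
  ⟨(Sum.inl x, a), by fin_cases a; exacts [Or.inl rfl, Or.inr rfl]⟩

/-- The admissible pair of the state `Δ` and the action `1`. -/
def cemeteryPair : (stoppingSMDP Q c g hc hg T).Pair := ⟨(Sum.inr (), 1), rfl⟩

theorem elapsed_continueHist_jumpHist (n : ℕ) (ω : MarkedPath E) :
    SMDP.elapsed (continueHist Q c g hc hg T (jumpHist n ω)) = jumpTime n ω := by
  rw [jumpTime, Finset.sum_range_succ']
  simp only [SMDP.elapsed, continueHist, jumpHist]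
  rw [Fin.sum_univ_eq_sum_range (fun m => sojourn (m + 1) ω)]
  simp [sojourn]

/-- The action of the policy at the jump of index `n`, provided that it has continued so far. -/
def pathAction (π : (stoppingSMDP Q c g hc hg T).DetPolicy) (s : ℝ) (n : ℕ)
    (ω : MarkedPath E) : Fin 2 :=
  π.action s (continueHist Q c g hc hg T (jumpHist n ω))

variable (π : (stoppingSMDP Q c g hc hg T).DetPolicy) (s : ℝ)

theorem pathAction_eq (n : ℕ) (ω : MarkedPath E) :
    pathAction π s n ω = π.d n (s - jumpTime n ω, continueHist Q c g hc hg T (jumpHist n ω)) := by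
  rw [pathAction, SMDP.DetPolicy.action, elapsed_continueHist_jumpHist]

theorem measurable_pathAction (n : ℕ) : Measurable (pathAction π s n) :=
  (π.measurable_action s n).comp ((measurable_continueHist n).comp
    ((measurable_jumpHist n).mono ((filtration E).le n) le_rfl))

open Classical in
/-- The path of the decision process driven by the path `ω` of the semi-Markov process: it follows
`ω` up to and including the first jump at which the policy stops, and from then on it sits in `Δ`
with sojourn times `T + 1`. -/
def controlledPath (ω : MarkedPath E) : MarkedPath (stoppingSMDP Q c g hc hg T).Pair := fun n =>
  if ∃ k < n, pathAction π s k ω = 1 then (T + 1, cemeteryPair)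
  else (sojourn n ω, statePair (mark n ω) (pathAction π s n ω))

variable {π s}

theorem controlledPath_of_stopped {n : ℕ} {ω : MarkedPath E}
    (h : ∃ k < n, pathAction π s k ω = 1) :
    controlledPath π s ω n = (T + 1, cemeteryPair) := by
  rw [controlledPath, if_pos h]

theorem controlledPath_of_not_stopped {n : ℕ} {ω : MarkedPath E}
    (h : ¬ ∃ k < n, pathAction π s k ω = 1) :
    controlledPath π s ω n =
      (sojourn n ω, statePair (mark n ω) (pathAction π s n ω)) := by
  rw [controlledPath, if_neg h]

theorem controlledPath_of_continuing {n : ℕ} {ω : MarkedPath E}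
    (h : ¬ ∃ k ≤ n, pathAction π s k ω = 1) :
    controlledPath π s ω n =
      (sojourn n ω, statePair (mark n ω) 0) := by
  rw [controlledPath_of_not_stopped fun ⟨k, hk, h'⟩ => h ⟨k, hk.le, h'⟩]
  have h0 : pathAction π s n ω = 0 := by
    have h1 : pathAction π s n ω ≠ 1 := fun h' => h ⟨n, le_rfl, h'⟩
    omega
  simp only [h0]

variable (π s)

theorem measurable_controlledPath : Measurable (controlledPath π s) := by
  refine measurable_pi_lambda _ fun n => ?_
  have hset : MeasurableSet {ω | ∃ k < n, pathAction π s k ω = 1} := by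
    have : {ω | ∃ k < n, pathAction π s k ω = 1} = ⋃ k < n, pathAction π s k ⁻¹' {1} := by
      ext ω; simp
    rw [this]
    exact MeasurableSet.iUnion fun k => MeasurableSet.iUnion fun _ =>
      measurable_pathAction π s k (measurableSet_singleton 1)
  refine Measurable.ite hset measurable_const ?_
  exact (measurable_sojourn n).prodMk (Measurable.subtype_mk
    ((measurable_inl.comp (measurable_mark n)).prodMk (measurable_pathAction π s n)))

theorem pathAction_congr {n : ℕ} {ω ω' : MarkedPath E} (h : ∀ k ≤ n, ω k = ω' k) :
    pathAction π s n ω = pathAction π s n ω' := by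
  have : jumpHist n ω = jumpHist n ω' := by
    refine Prod.ext (funext fun m => ?_) (Prod.ext (funext fun m => ?_) ?_)
    · simp only [jumpHist, mark]; rw [h m m.2.le]
    · simp only [jumpHist, sojourn]; rw [h (m + 1) m.2]
    · simp only [jumpHist, mark]; rw [h n le_rfl]
  rw [pathAction, pathAction, this]

theorem controlledPath_congr {n : ℕ} {ω ω' : MarkedPath E} (h : ∀ k ≤ n, ω k = ω' k) :
    controlledPath π s ω n = controlledPath π s ω' n := by
  have hiff : (∃ k < n, pathAction π s k ω = 1) ↔ ∃ k < n, pathAction π s k ω' = 1 :=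
    exists_congr fun k => and_congr_right fun hk => by
      rw [pathAction_congr π s fun j hj => h j (hj.trans hk.le)]
  by_cases hs : ∃ k < n, pathAction π s k ω = 1
  · rw [controlledPath_of_stopped hs, controlledPath_of_stopped (hiff.1 hs)]
  · rw [controlledPath_of_not_stopped hs, controlledPath_of_not_stopped (mt hiff.2 hs)]
    have h1 : sojourn n ω = sojourn n ω' := by simp only [sojourn]; rw [h n le_rfl]
    have h2 : mark n ω = mark n ω' := by simp only [mark]; rw [h n le_rfl]
    simp only [h1, h2, pathAction_congr π s h]

/-- As long as the policy continues, the history of the controlled path is the history of the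
driving path with all actions `0`. -/
theorem transition_controlledPath {n : ℕ} {ω : MarkedPath E}
    (h : ¬ ∃ k ≤ n, pathAction π s k ω = 1) (p : ℝ≥0 × E) :
    π.transition s (Preorder.frestrictLe n (controlledPath π s ω)) (p.1, Sum.inl p.2) =
      controlledPath π s (Function.update ω (n + 1) p) (n + 1) := by
  set ω' : MarkedPath E := Function.update ω (n + 1) p with hω'
  have hag : ∀ k ≤ n, ω' k = ω k := fun k hk => Function.update_of_ne (by omega) _ _
  have hlast : ω' (n + 1) = p := Function.update_self _ _ _
  have h' : ¬ ∃ k < n + 1, pathAction π s k ω' = 1 := by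
    rintro ⟨k, hk, h1⟩
    refine h ⟨k, Nat.lt_succ_iff.1 hk, ?_⟩
    rw [← h1]
    exact pathAction_congr π s fun j hj => (hag j (hj.trans (Nat.lt_succ_iff.1 hk))).symm
  have hpast : ∀ m ≤ n, controlledPath π s ω m =
      (sojourn m ω', statePair (mark m ω') 0) := by
    intro m hm
    rw [controlledPath_congr π s fun j hj => (hag j (hj.trans hm)).symm]
    exact controlledPath_of_continuing fun ⟨k, hk, h1⟩ => h' ⟨k, by omega, h1⟩
  have hhist : (stoppingSMDP Q c g hc hg T).nextHist n
      (Preorder.frestrictLe n (controlledPath π s ω), (p.1, Sum.inl p.2)) =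
        continueHist Q c g hc hg T (jumpHist (n + 1) ω') := by
    refine Prod.ext (funext fun m => ?_) (Prod.ext (funext fun m => ?_) ?_)
    · simp only [SMDP.nextHist, Preorder.frestrictLe_apply, continueHist, jumpHist]
      rw [hpast m (Nat.lt_succ_iff.1 m.2)]
      rfl
    · simp only [SMDP.nextHist, Preorder.frestrictLe_apply, continueHist, jumpHist]
      induction m using Fin.lastCases with
      | last => simp [sojourn, hlast]
      | cast m =>
        rw [Fin.snoc_castSucc, hpast (m + 1) m.2]
        rfl
    · simp [SMDP.nextHist, continueHist, jumpHist, mark, hlast]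
  rw [controlledPath_of_not_stopped h']
  refine Prod.ext ?_ (Subtype.ext (Prod.ext ?_ ?_))
  · simp [SMDP.DetPolicy.transition, sojourn, hlast]
  · simp [SMDP.DetPolicy.transition, statePair, mark, hlast]
  · change π.action s _ = pathAction π s (n + 1) ω'
    rw [hhist, pathAction]

/-- The controlled path has the law of the decision process under the policy. -/
theorem map_controlledPath_smpMeasure [StandardBorelSpace E] (x : E) :
    (smpMeasure Q x).map (controlledPath π s) = SMDP.pathMeasure π.toPolicy s (Sum.inl x) := by
  refine map_trajMeasure (measurable_controlledPath π s)
    (fun n ω ω' h => controlledPath_congr π s h) ?_ fun n ω => ?_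
  · have hm : Measurable fun p : ℝ≥0 × E => controlledPath π s (fun _ => p) 0 :=
      (measurable_pi_apply 0).comp ((measurable_controlledPath π s).comp
        (measurable_pi_lambda _ fun _ => measurable_id))
    rw [Measure.map_dirac' (f := fun p => controlledPath π s (fun _ => p) 0) hm,
      SMDP.DetPolicy.initialLaw_toPolicy]
    congr 1
    rw [controlledPath_of_not_stopped (by simp)]
    have hh : continueHist Q c g hc hg T (jumpHist 0 (fun _ => (0, x))) =
        (Fin.elim0, Fin.elim0, Sum.inl x) :=
      Prod.ext (funext fun m => m.elim0) (Prod.ext (funext fun m => m.elim0) rfl)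
    simp only [pathAction, hh]
    rfl
  · rw [SMDP.DetPolicy.stepKernel_toPolicy, Kernel.comap_apply]
    change Measure.map _ (Q.joint (ω n).2) =
      ((stopKernel Q T).joint (controlledPath π s ω n).2).map _
    by_cases h : ∃ k ≤ n, pathAction π s k ω = 1
    · -- after a stop, the law of the next step is the Dirac measure at `(T + 1, Δ)`
      have hact : (controlledPath π s ω n).2.1.2 = 1 := by
        by_cases hs : ∃ k < n, pathAction π s k ω = 1
        · rw [controlledPath_of_stopped hs]; rfl
        · rw [controlledPath_of_not_stopped hs]
          obtain ⟨k, hk, h1⟩ := h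
          rcases hk.lt_or_eq with hk | rfl
          · exact absurd ⟨k, hk, h1⟩ hs
          · exact h1
      rw [joint_stopKernel_stop Q T hact, Measure.map_dirac' (π.measurable_transition s _)]
      have hconst : (fun p => controlledPath π s (Function.update ω (n + 1) p) (n + 1)) =
          fun _ => (T + 1, cemeteryPair) := by
        funext p
        obtain ⟨k, hk, h1⟩ := h
        refine controlledPath_of_stopped ⟨k, Nat.lt_succ_iff.2 hk, ?_⟩
        rw [← h1]
        exact pathAction_congr π s fun j hj => Function.update_of_ne (by omega) _ _
      rw [hconst, Measure.map_const, measure_univ, one_smul]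
      congr 1
      refine Prod.ext rfl (Subtype.ext (Prod.ext rfl ?_))
      exact (π.admissible (n + 1) _ ((stoppingSMDP Q c g hc hg T).nextHist n
        (Preorder.frestrictLe n (controlledPath π s ω), (T + 1, Sum.inr ())))).symm
    · -- while the policy continues, the next step is drawn from `Q` at the current state
      rw [controlledPath_of_continuing h]
      change _ = ((stopKernel Q T).joint ⟨(Sum.inl (ω n).2, 0), _⟩).map _
      have hinl : Measurable fun p : ℝ≥0 × E => (p.1, (Sum.inl p.2 : E ⊕ Unit)) :=
        measurable_fst.prodMk (measurable_inl.comp measurable_snd)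
      rw [joint_stopKernel_continue, Measure.map_map (π.measurable_transition s _) hinl]
      congr 1
      funext p
      exact (transition_controlledPath π s h p).symm

/-! ### Comparison of the costs -/

variable {π s}

theorem jumpTime_controlledPath {n : ℕ} {ω : MarkedPath E}
    (h : ¬ ∃ k < n, pathAction π s k ω = 1) :
    jumpTime n (controlledPath π s ω) = jumpTime n ω := by
  refine Finset.sum_congr rfl fun m hm => ?_
  have hm := Nat.lt_succ_iff.1 (Finset.mem_range.1 hm)
  rw [sojourn, controlledPath_of_not_stopped fun ⟨k, hk, h1⟩ => h ⟨k, hk.trans_le hm, h1⟩]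
  by_cases h0 : m = 0 <;> simp [sojourn, h0]

/-- Before the time at which the policy stops, the controlled path has the marks of the driving
path, with action `0`. -/
theorem valueAt_controlledPath_of_lt (f : (stoppingSMDP Q c g hc hg T).Pair → ℝ≥0) {t : ℝ}
    {ω : MarkedPath E} (h : ∀ n, pathAction π s n ω = 1 → t < jumpTime n ω) :
    valueAt f t (controlledPath π s ω) =
      valueAt (fun x => f (statePair x 0)) t ω := by
  by_cases hex : ∃ n, (jumpTime n ω : ℝ) ≤ t ∧ t < jumpTime (n + 1) ω
  · obtain ⟨n, h1, h2⟩ := hex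
    have hns : ¬ ∃ k ≤ n, pathAction π s k ω = 1 := by
      rintro ⟨k, hk, hk1⟩
      have h3 : jumpTime k ω ≤ jumpTime n ω := jumpTime_mono ω hk
      exact absurd (h k hk1) (not_lt.2 ((NNReal.coe_le_coe.2 h3).trans h1))
    have e1 : jumpTime n (controlledPath π s ω) = jumpTime n ω :=
      jumpTime_controlledPath fun ⟨k, hk, hk1⟩ => hns ⟨k, hk.le, hk1⟩
    have e2 : jumpTime (n + 1) (controlledPath π s ω) = jumpTime (n + 1) ω :=
      jumpTime_controlledPath fun ⟨k, hk, hk1⟩ => hns ⟨k, Nat.lt_succ_iff.1 hk, hk1⟩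
    rw [valueAt_of_mem _ h1 h2, valueAt_of_mem f (n := n) (by rwa [e1]) (by rwa [e2]), mark,
      controlledPath_of_continuing hns]
  · push Not at hex
    rw [valueAt_of_forall _ hex, valueAt_of_forall]
    intro n hn
    have ht : (0 : ℝ) ≤ t := (NNReal.coe_nonneg _).trans hn
    -- `t` is at or after an accumulation point, so that the policy does not stop at any jump
    have hall : ∀ m, (jumpTime m ω : ℝ) ≤ t := by
      intro m
      induction m with
      | zero => simpa [jumpTime_zero] using ht
      | succ m ih => exact hex m ih
    rw [jumpTime_controlledPath fun ⟨k, _, hk1⟩ => absurd (h k hk1) (not_lt.2 (hall k))]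
    exact hall (n + 1)

/-- The step after the stop has length `T + 1`, so that the mark at the stop persists for this
time, with action `1`. -/
theorem valueAt_controlledPath_of_stop (f : (stoppingSMDP Q c g hc hg T).Pair → ℝ≥0) {t : ℝ}
    {ω : MarkedPath E} {N : ℕ} (hN : pathAction π s N ω = 1)
    (hmin : ¬ ∃ k < N, pathAction π s k ω = 1) (h1 : (jumpTime N ω : ℝ) ≤ t) (h2 : t < T + 1) :
    valueAt f t (controlledPath π s ω) =
      f (statePair (mark N ω) 1) := by
  have e : jumpTime N (controlledPath π s ω) = jumpTime N ω := jumpTime_controlledPath hmin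
  rw [valueAt_of_mem f (n := N) (by rwa [e]), mark, controlledPath_of_not_stopped hmin]
  · simp only [hN]
  · rw [jumpTime_succ, sojourn, if_neg (Nat.succ_ne_zero N),
      controlledPath_of_stopped ⟨N, Nat.lt_succ_self N, hN⟩]
    push_cast
    have := NNReal.coe_nonneg (jumpTime N (controlledPath π s ω))
    linarith

theorem inducedTime_eq_of_stop {ω : MarkedPath E} {N : ℕ} (hN : pathAction π s N ω = 1)
    (hmin : ¬ ∃ k < N, pathAction π s k ω = 1) : inducedTime π s ω = N := by
  refine IsLeast.csInf_eq ⟨⟨N, ?_, rfl⟩, ?_⟩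
  · exact (pathAction_eq π s N ω).symm.trans hN
  · rintro _ ⟨k, hk, rfl⟩
    have hk' : pathAction π s k ω = 1 := (pathAction_eq π s k ω).trans hk
    exact Nat.cast_le.2 (not_lt.1 fun hlt => hmin ⟨k, hlt, hk'⟩)

theorem inducedTime_eq_top {ω : MarkedPath E} (h : ∀ n, pathAction π s n ω ≠ 1) :
    inducedTime π s ω = ⊤ := by
  have : {n | π.d n (s - jumpTime n ω, continueHist Q c g hc hg T (jumpHist n ω)) = 1} = ∅ :=
    eq_empty_of_forall_notMem fun n hn => h n ((pathAction_eq π s n ω).trans hn)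
  rw [inducedTime, this, image_empty, sInf_empty]

variable (π)

/-- If the policy stops first at the jump of index `N` and `S_N < s`, the decision process stays in
`(X_N, 1)` from `S_N` until after the horizon, so that it pays `g(X_N)` at the horizon. -/
theorem cost_controlledPath (hπ : π ∈ continuingAtZero Q c g hc hg T) {s : ℝ≥0} (hs : s ≤ T)
    {ω : MarkedPath E} (hω : ∀ n, 0 < sojourn (n + 1) ω) :
    accumulated (stoppingSMDP Q c g hc hg T).c s (controlledPath π s ω) +
        valueAt (stoppingSMDP Q c g hc hg T).g s (controlledPath π s ω) =
      stoppingCost c g s (inducedStoppingTime π s) ω := by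
  -- if the policy does not stop up to time `s`, only the cost rate on `E` contributes
  have hlate : (∀ n, pathAction π s n ω = 1 → (s : ℝ) < jumpTime n ω) →
      accumulated (stoppingSMDP Q c g hc hg T).c s (controlledPath π s ω) +
          valueAt (stoppingSMDP Q c g hc hg T).g s (controlledPath π s ω) =
        accumulated c s ω := by
    intro h
    have hg0 : valueAt (stoppingSMDP Q c g hc hg T).g s (controlledPath π s ω) = 0 := by
      rw [valueAt_controlledPath_of_lt (stoppingSMDP Q c g hc hg T).g h]
      have : (fun x => (stoppingSMDP Q c g hc hg T).g (statePair x 0)) = fun _ : E => 0 := rfl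
      rw [this, valueAt]
      rcases atTime (s : ℝ) ω with _ | x <;> rfl
    rw [hg0, add_zero]
    refine setLIntegral_congr_fun measurableSet_Icc fun t ht => ?_
    exact valueAt_controlledPath_of_lt (stoppingSMDP Q c g hc hg T).c fun n hn =>
      ht.2.trans_lt (h n hn)
  by_cases hex : ∃ n, pathAction π s n ω = 1
  · classical
    obtain ⟨N, hN, hmin⟩ : ∃ N, pathAction π s N ω = 1 ∧
        ¬ ∃ k < N, pathAction π s k ω = 1 :=
      ⟨Nat.find hex, Nat.find_spec hex, fun ⟨k, hk, h1⟩ => Nat.find_min hex hk h1⟩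
    have hfirst : ∀ n, pathAction π s n ω = 1 → jumpTime N ω ≤ jumpTime n ω := fun n hn =>
      jumpTime_mono ω (not_lt.1 fun hlt => hmin ⟨n, hlt, hn⟩)
    have hτ : jumpTimeAt ((inducedStoppingTime π s).1 ω) ω = (jumpTime N ω : ℝ≥0∞) := by
      change jumpTimeAt (inducedTime π s ω) ω = _
      rw [inducedTime_eq_of_stop hN hmin, jumpTimeAt, if_neg (ENat.natCast_ne_top N)]
      rfl
    rw [stoppingCost, hτ, ENNReal.coe_toReal]
    by_cases hlt : jumpTime N ω < s
    · have hlt' : (jumpTime N ω : ℝ) < s := NNReal.coe_lt_coe.2 hlt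
      have hs' : (s : ℝ) < T + 1 := by
        have := NNReal.coe_le_coe.2 hs
        linarith
      rw [if_pos (ENNReal.coe_lt_coe.2 hlt)]
      congr 1
      · have hsplit : Icc (0 : ℝ) s = Ico 0 (jumpTime N ω : ℝ) ∪ Icc (jumpTime N ω : ℝ) s :=
          (Ico_union_Icc_eq_Icc (NNReal.coe_nonneg _) hlt'.le).symm
        rw [accumulated, hsplit, lintegral_union measurableSet_Icc
          (disjoint_left.2 fun t h1 h2 => absurd h1.2 (not_lt.2 h2.1))]
        have h0 : ∫⁻ t in Icc (jumpTime N ω : ℝ) s,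
            valueAt (stoppingSMDP Q c g hc hg T).c t (controlledPath π s ω) = 0 := by
          rw [setLIntegral_congr_fun (g := fun _ => 0) measurableSet_Icc, lintegral_zero]
          intro t ht
          exact valueAt_controlledPath_of_stop (stoppingSMDP Q c g hc hg T).c hN hmin ht.1
            (ht.2.trans_lt hs')
        rw [h0, add_zero, accumulated, ← restrict_Ico_eq_restrict_Icc]
        refine setLIntegral_congr_fun measurableSet_Ico fun t ht => ?_
        exact valueAt_controlledPath_of_lt (stoppingSMDP Q c g hc hg T).c fun n hn =>
          ht.2.trans_le (NNReal.coe_le_coe.2 (hfirst n hn))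
      · rw [valueAt_controlledPath_of_stop (stoppingSMDP Q c g hc hg T).g hN hmin hlt'.le hs',
          valueAt_of_mem g le_rfl]
        · rfl
        · rw [jumpTime_succ]
          exact_mod_cast lt_add_of_pos_right _ (hω N)
    · -- a stop at time exactly `s` is excluded, as the remaining horizon would be `0`
      have hne : jumpTime N ω ≠ s := by
        intro heq
        have h0 := hπ N (jumpHist N ω)
        rw [pathAction_eq, heq, sub_self, h0] at hN
        exact zero_ne_one hN
      rw [if_neg (by exact_mod_cast hlt)]
      refine hlate fun n hn => NNReal.coe_lt_coe.2 ?_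
      exact (lt_of_le_of_ne (not_lt.1 hlt) hne.symm).trans_le (hfirst n hn)
  · push Not at hex
    have hτ : jumpTimeAt ((inducedStoppingTime π s).1 ω) ω = ∞ := by
      change jumpTimeAt (inducedTime π s ω) ω = _
      rw [inducedTime_eq_top hex, jumpTimeAt, if_pos rfl]
    rw [stoppingCost, hτ, if_neg (by simp)]
    exact hlate fun n hn => absurd hn (hex n)

end Stopping

end

theorem mainTheorem3 {E : Type*} [MeasurableSpace E] [StandardBorelSpace E]
    (Q : SemiMarkovKernel E E)
    (hQ : ∃ δ : ℝ≥0, 0 < δ ∧ ∃ ε : ℝ, 0 < ε ∧ ∀ x, (Q.law δ x).real univ ≤ 1 - ε)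
    (c g : E → ℝ≥0) (hc : Measurable c) (hg : Measurable g) (T : ℝ≥0)
    (π : (stoppingSMDP Q c g hc hg T).DetPolicy) (hπ : π ∈ continuingAtZero Q c g hc hg T) :
    ∀ (x : E) (s : ℝ≥0), s ≤ T →
      SMDP.expectedCost π.toPolicy s (Sum.inl x) =
        expectedStoppingCost Q c g (inducedStoppingTime π s) s x := by
  intro x s hs
  have hm : Measurable fun ω => MarkedPath.accumulated (stoppingSMDP Q c g hc hg T).c s ω +
      MarkedPath.valueAt (stoppingSMDP Q c g hc hg T).g s ω :=
    (MarkedPath.measurable_accumulated (stoppingSMDP Q c g hc hg T).measurable_c _).add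
      (MarkedPath.measurable_valueAt (stoppingSMDP Q c g hc hg T).measurable_g _)
  rw [SMDP.expectedCost, ← map_controlledPath_smpMeasure,
    lintegral_map hm (measurable_controlledPath π s), expectedStoppingCost]
  refine lintegral_congr_ae ?_
  filter_upwards [ae_sojourn_pos Q x] with ω hω
  exact cost_controlledPath π hπ hs hω
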